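/- **Setting.** For $a\in\mathbb Z$ let $g_a(x)=(x+a)^2-a-2$. Its critical point $-a$ has the post-critical orbit $\gamma_1=-a-2\mapsto\gamma_2=2-a\mapsto\gamma_2$. For a prime $p$, the *type* of an irreducible $h\in\mathbb F_p[x]$ is the word of length $2$ whose $i$-th letter is $s$ if $h(\gamma_i)$ is a square in $\mathbb F_p$ and $n$ otherwise; the *factorization type* of a polynomial is the formal product of the symbols $[\text{type},\text{degree}]$ over its irreducible factors. *Model 4.* The level $1$ data are the weighted formal products $([ss,2],\tfrac12)$, $([nn,1]^2,\tfrac14)$, $([ss,1]^2,\tfrac14)$. The level $n+1$ data arise from the level $n$ data by replacing, independently, each factor by its children, following the Markov process of $g_a$ at primes $\equiv 1 \pmod 4$: a factor $[t_1t_2,d]$ with $t_1=n$ is replaced by $[t_2t_2,2d]$; if $t_1=s$, it is replaced by $[T,d][T',d]$ with $TT'=t_2t_2$ (letterwise, $ss=nn=s$, $sn=ns=n$) and the last letter of each of $T,T'$ equal to the first letter of the other, all such pairs being equally likely. Explicitly, $[nn,d]\to[nn,2d]$, $[ns,d]\to[ss,2d]$, $[sn,d]\to[ns,d][sn,d]$,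 and $[ss,d]\to[nn,d]^2$ or $[ss,d]^2$ with probability $\tfrac12$ each. The level $n$ *cycle data* consist of the partitions of $2^n$ (multisets of degrees) that occur at level $n$, each with its total weight. *The groups.* Let $T_n$ be the complete binary rooted tree of height $n$ with leaves $1,\dots,2^n$ from left to right, $W_n=\mathrm{Aut}(T_n)\le S_{2^n}$, and view $W_i\le W_n$ for $i\le n$ (acting on $1,\dots,2^i$, fixing the other leaves). Permutations are composed from right to left. Put $a_i=(1,2^{i-1}+1)(2,2^{i-1}+2)\cdots(2^{i-1},2^i)$, $x_i=a_1a_2\cdots a_i$ ($x_0=1$), $v_i=x_{i+2}^2$, $m_1=1$, and $m_n=a_{n-1}\,x_nx_{n-2}x_n^{-1}$ for $n\ge2$. Let $M_n=\langle x_n,m_n,v_0,\dots,v_{n-3}\rangle$ (no $v_i$ if $n\le 2$), let $N_n$ be the normal closure of $\langle m_n,v_0,\dots,v_{n-3}\rangle$ in $M_n$, let $N_n^{od}$ be the set of $g\in N_n$ for which $x_ng$ is transitive on the leaves of $T_n$, and let $M_n(2)=\langle x_nm_n,\ N_n^{od}\rangle$. **Corollary 5.18.** Let $a=2+b^2$ or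 $a=2-b^2$ with $b\in\mathbb Z$, and suppose that $g_a$ is irreducible. For every prime $p\equiv1\pmod 4$ the factorization type of $g_a$ modulo $p$ is one of $[ss,2]$, $[nn,1]^2$, $[ss,1]^2$. Moreover, for every $n\ge1$, $M_n(2)$ is a subgroup of $\mathrm{Aut}(T_n)$ and satisfies Model 4: the cycle types (fixed points included) that occur in $M_n(2)$, each with the proportion of elements of $M_n(2)$ having it, are exactly the level $n$ cycle data of Model 4. -/

import Mathlib

open Polynomial

namespace EvenMarkov

/-! ### The polynomials and the types of their factors modulo primes -/

/-- `g_a(x) = (x + a)² - a - 2`. -/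
noncomputable def gPoly (a : ℤ) : ℤ[X] := (X + C a) ^ 2 - C a - 2

/-- `postcrit a k` is `g_a^k(c)`, where `c = -a` is the critical point of `g_a`. -/
noncomputable def postcrit (a : ℤ) (k : ℕ) : ℤ := (fun z => (gPoly a).eval z)^[k] (-a)

/-- The critical point `-a` is strictly preperiodic: the post-critical orbit has the two elements
`γ₁ = g_a(c)`, `γ₂ = g_a²(c)`, with `γ₁ ↦ γ₂ ↦ γ₂`; the tail is `{γ₁}`. -/
theorem postcrit_portrait (a : ℤ) :
    postcrit a 1 ≠ postcrit a 2 ∧ postcrit a 3 = postcrit a 2 := by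
  have h2 : (2 : ℤ[X]) = C 2 := rfl
  constructor
  · simp only [postcrit, gPoly, Function.iterate_succ, Function.iterate_zero, Function.comp, id,
      h2, eval_sub, eval_pow, eval_add, eval_X, eval_C]
    intro h
    ring_nf at h
    omega
  · simp only [postcrit, gPoly, Function.iterate_succ, Function.iterate_zero, Function.comp, id,
      h2, eval_sub, eval_pow, eval_add, eval_X, eval_C]
    ring

/-- A type: a string of length two, first entry at `γ₁`, second entry at `γ₂`.
The letter `s` (square) is `true`, the letter `n` (not a square) is `false`. -/
abbrev FType := Bool × Bool

/-- The type `nn`. -/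
def nn : FType := (false, false)

/-- The type `ss`. -/
def ss : FType := (true, true)

open Classical in
/-- The type of a polynomial `h` over `𝔽_p`: which of `h(γ₁)`, `h(γ₂)` are squares in `𝔽_p`. -/
noncomputable def typeOf (a : ℤ) (p : ℕ) (h : (ZMod p)[X]) : FType :=
  (decide (IsSquare (h.eval ((postcrit a 1 : ℤ) : ZMod p))),
   decide (IsSquare (h.eval ((postcrit a 2 : ℤ) : ZMod p))))

open Classical in
/-- The factorization type of `g_a` modulo `p`: the formal product of `[type, degree]` over the
irreducible factors, as a multiset. -/
noncomputable def factType (a : ℤ) (p : ℕ) [Fact p.Prime] : Multiset (FType × ℕ) :=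
  (UniqueFactorizationMonoid.normalizedFactors
    ((gPoly a).map (Int.castRingHom (ZMod p)))).map (fun h => (typeOf a p h, h.natDegree))

/-! ### The Markov process of `g_a` at the primes congruent to `1` modulo `4` -/

/-- The action of `g_a` on types: the entry of the new type at `γ` is the entry of the old one at
`g_a(γ)`, and `γ₁ ↦ γ₂ ↦ γ₂`. -/
def act (T : FType) : FType := (T.2, T.2)

/-- Entrywise product of types, with the sign rule `ss = nn = s`, `sn = ns = n` for letters. -/
def mulType (T₁ T₂ : FType) : FType := (T₁.1 == T₂.1, T₁.2 == T₂.2)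

/-- The allowable (ordered) pairs of types of the two children of a factor of type `T` starting
with `s`: their product is `act T`, and, as `g_a` has post-critical orbit of size `2` and tail of
size `1`, the last digit of each child is the first digit of the other. -/
def allowable (T : FType) : Finset (FType × FType) :=
  Finset.univ.filter fun P =>
    mulType P.1 P.2 = act T ∧ P.1.2 = P.2.1 ∧ P.2.2 = P.1.1

theorem allowable_nonempty (T : FType) : (allowable T).Nonempty := by
  revert T
  decide

/-- A formal product `∏ [tᵢ, dᵢ]`, written as a list. Only order-independent
information is ever read off from it. -/
abbrev Datum := List (FType × ℕ)

/-- The random children of a factor `[T, d]`. A type starting with `n` gives the single factor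
`[act T, 2d]`; a type starting with `s` gives two factors `[T₁, d][T₂, d]`, all allowable pairs
`(T₁, T₂)` being equally likely. That is,
`[nn,d] → [nn,2d]`, `[ns,d] → [ss,2d]`, `[sn,d] → [ns,d][sn,d]`, and
`[ss,d] → [nn,d][nn,d]` or `[ss,d][ss,d]`, each with probability `1/2`. -/
noncomputable def children (F : FType × ℕ) : PMF Datum :=
  if F.1.1 = true then
    (PMF.uniformOfFinset (allowable F.1) (allowable_nonempty F.1)).map
      (fun P => [(P.1, F.2), (P.2, F.2)])
  else PMF.pure [(act F.1, 2 * F.2)]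

/-- One step of the Markov process on a formal product: all the factors are replaced,
independently of one another, by their children. -/
noncomputable def step : Datum → PMF Datum
  | [] => PMF.pure []
  | F :: L => (children F).bind fun D => (step L).map fun E => D ++ E

/-- The three formal products `[ss,2]`, `[nn,1][nn,1]`, `[ss,1][ss,1]`. -/
def firstLevel : Finset Datum := {[(ss, 2)], [(nn, 1), (nn, 1)], [(ss, 1), (ss, 1)]}

/-- The weights `1/2`, `1/4`, `1/4` of `[ss,2]`, `[nn,1][nn,1]`, `[ss,1][ss,1]`. -/
noncomputable def firstWeight (D : Datum) : ENNReal :=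
  if D = [(ss, 2)] then 1 / 2
  else if D = [(nn, 1), (nn, 1)] then 1 / 4
  else if D = [(ss, 1), (ss, 1)] then 1 / 4
  else 0

/-- The first level data `([ss,2],1/2), ([nn,1][nn,1],1/4), ([ss,1][ss,1],1/4)`. -/
noncomputable def model4 : PMF Datum :=
  PMF.ofFinset firstWeight firstLevel
    (by
      have h : (4 : ENNReal)⁻¹ + 4⁻¹ = 2⁻¹ := by
        have h4 : (4 : ENNReal) = 2 * 2 := by norm_num
        rw [h4, ENNReal.mul_inv (by simp) (by simp), ← mul_add, ENNReal.inv_two_add_inv_two,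
          mul_one]
      simp [firstLevel, firstWeight, nn, ss, h, ENNReal.inv_two_add_inv_two])
    (by
      intro D hD
      simp only [firstLevel, Finset.mem_insert, Finset.mem_singleton, not_or] at hD
      simp [firstWeight, hD.1, hD.2.1, hD.2.2])

/-- The level `n` data (`n ≥ 1`): the Markov process applied `n - 1` times to the first level. -/
noncomputable def levelData (n : ℕ) : PMF Datum := (fun D => D.bind step)^[n - 1] model4

/-- The partition underlying a formal product: the multiset of the degrees. -/
def degrees (D : Datum) : Multiset ℕ := (D.map Prod.snd : Multiset ℕ)

/-- The level `n` cycle data: the partitions that occur in the level `n` data, each with its total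
weight. -/
def levelCycleData (n : ℕ) : Set (Multiset ℕ × ℝ) :=
  {q | q.1 ∈ ((levelData n).map degrees).support ∧ q.2 = (((levelData n).map degrees) q.1).toReal}

/-! ### Automorphisms of the binary tree and the groups

The leaves of the binary rooted tree `T_n` of height `n` are labelled `0, …, 2^n - 1` from left to
right. The vertices at height `k` above the leaves are the blocks `{j | j / 2^k = q}`. -/

/-- `W_n = Aut(T_n)`, as a group of permutations of the leaves. -/
def treeAut (n : ℕ) : Subgroup (Equiv.Perm (Fin (2 ^ n))) where
  carrier := {w | ∀ (k : ℕ) (i j : Fin (2 ^ n)),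
    (w i : ℕ) / 2 ^ k = (w j : ℕ) / 2 ^ k ↔ (i : ℕ) / 2 ^ k = (j : ℕ) / 2 ^ k}
  mul_mem' := by
    intro u v hu hv k i j
    simp only [Equiv.Perm.mul_apply]
    rw [hu, hv]
  one_mem' := by
    intro k i j
    simp
  inv_mem' := by
    intro u hu k i j
    rw [← hu k (u⁻¹ i) (u⁻¹ j)]
    simp

/-- The map `j ↦ j ± 2^(i-1)` that exchanges `{0,…,2^(i-1)-1}` and `{2^(i-1),…,2^i-1}` and fixes
the other leaves. -/
def exchange (n i : ℕ) (h : 1 ≤ i ∧ i ≤ n) (j : Fin (2 ^ n)) : Fin (2 ^ n) :=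
  if hj : (j : ℕ) < 2 ^ (i - 1) then
    ⟨j + 2 ^ (i - 1), by
      have h1 : 2 ^ i = 2 * 2 ^ (i - 1) := by
        rw [← pow_succ', Nat.sub_add_cancel h.1]
      have h2 : 2 ^ i ≤ 2 ^ n := Nat.pow_le_pow_right (by norm_num) h.2
      omega⟩
  else if (j : ℕ) < 2 ^ i then
    ⟨j - 2 ^ (i - 1), lt_of_le_of_lt (Nat.sub_le _ _) j.isLt⟩
  else j

theorem exchange_involutive (n i : ℕ) (h : 1 ≤ i ∧ i ≤ n) :
    Function.Involutive (exchange n i h) := by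
  have h1 : 2 ^ i = 2 * 2 ^ (i - 1) := by
    rw [← pow_succ', Nat.sub_add_cancel h.1]
  intro j
  obtain ⟨j, hj⟩ := j
  by_cases hA : j < 2 ^ (i - 1)
  · have hB : ¬ (j + 2 ^ (i - 1) < 2 ^ (i - 1)) := by omega
    have hC : j + 2 ^ (i - 1) < 2 ^ i := by omega
    simp [exchange, hA, hC]
  · by_cases hC : j < 2 ^ i
    · have hD : j - 2 ^ (i - 1) < 2 ^ (i - 1) := by omega
      have hE : j - 2 ^ (i - 1) + 2 ^ (i - 1) = j := by omega
      simp [exchange, hA, hC, hD, hE]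
    · simp [exchange, hA, hC]

/-- The generator `a_i ∈ W_n`, `1 ≤ i ≤ n`. In `1`-based labels it is
`(1, 2^(i-1)+1)(2, 2^(i-1)+2)⋯(2^(i-1), 2^i)`. -/
def genA (n i : ℕ) : Equiv.Perm (Fin (2 ^ n)) :=
  if h : 1 ≤ i ∧ i ≤ n then (exchange_involutive n i h).toPerm else 1

/-- `x_i = a_1 a_2 ⋯ a_i ∈ W_i`, viewed in `W_n` for `i ≤ n`; permutations are composed from right
to left. -/
def odo (n : ℕ) : ℕ → Equiv.Perm (Fin (2 ^ n))
  | 0 => 1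
  | i + 1 => odo n i * genA n (i + 1)

/-- `v_i = x_{i+2}²`, viewed in `W_n`. -/
def vElt (n i : ℕ) : Equiv.Perm (Fin (2 ^ n)) := odo n (i + 2) ^ 2

/-- `m_1 = 1` and `m_n = a_{n-1} · x_n x_{n-2} x_n⁻¹` for `n ≥ 2`; in particular `m_2 = a_1`. -/
def mElt : (n : ℕ) → Equiv.Perm (Fin (2 ^ n))
  | 0 => 1
  | 1 => 1
  | n + 2 => genA (n + 2) (n + 1) *
      (odo (n + 2) (n + 2) * odo (n + 2) n * (odo (n + 2) (n + 2))⁻¹)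

/-- `M_n = ⟨x_n, m_n, v_{n-3}, …, v_0⟩`. -/
def grpM (n : ℕ) : Subgroup (Equiv.Perm (Fin (2 ^ n))) :=
  Subgroup.closure ({odo n n, mElt n} ∪ {w | ∃ i, i + 3 ≤ n ∧ w = vElt n i})

/-- `H_n = ⟨m_n, v_{n-3}, …, v_0⟩`. -/
def grpH (n : ℕ) : Subgroup (Equiv.Perm (Fin (2 ^ n))) :=
  Subgroup.closure ({mElt n} ∪ {w | ∃ i, i + 3 ≤ n ∧ w = vElt n i})

/-- `N_n`, the normal closure of `H_n` in `M_n`. -/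
def grpN (n : ℕ) : Subgroup (Equiv.Perm (Fin (2 ^ n))) :=
  (Subgroup.normalClosure (((grpH n).subgroupOf (grpM n) : Subgroup (grpM n)) :
    Set (grpM n))).map (grpM n).subtype

/-- `w` is an `n`-odometer: it acts transitively on the leaves of `T_n`
(hence, if it is a tree automorphism, on each level). -/
def IsOdometer (n : ℕ) (w : Equiv.Perm (Fin (2 ^ n))) : Prop :=
  ∀ i j, w.SameCycle i j

/-- `G^od`: the elements `g` of `G` such that `x_n g` is an `n`-odometer. -/
def od (n : ℕ) (G : Subgroup (Equiv.Perm (Fin (2 ^ n)))) : Set (Equiv.Perm (Fin (2 ^ n))) :=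
  {w | w ∈ G ∧ IsOdometer n (odo n n * w)}

/-- `M_n(2) = ⟨x_n m_n, N_n^od⟩`. -/
def grpM2 (n : ℕ) : Subgroup (Equiv.Perm (Fin (2 ^ n))) :=
  Subgroup.closure ({odo n n * mElt n} ∪ od n (grpN n))

/-- The cycle type of a permutation, fixed points included. -/
def cyc {n : ℕ} (w : Equiv.Perm (Fin (2 ^ n))) : Multiset ℕ := w.partition.parts

/-- The cycle data of `G`: the cycle types that occur in `G`, each with the proportion of the
elements of `G` that have it. -/
def cycleData {n : ℕ} (G : Subgroup (Equiv.Perm (Fin (2 ^ n)))) : Set (Multiset ℕ × ℝ) :=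
  {q | (∃ w ∈ G, cyc w = q.1) ∧
    q.2 = (Nat.card {w : G // cyc (w : Equiv.Perm (Fin (2 ^ n))) = q.1} : ℝ) / (Nat.card G : ℝ)}

end EvenMarkov

/-!
Let `c` be a square root of `a + 2` in an algebraic closure of `𝔽_p`. If `c ∉ 𝔽_p`, then
`g_a` is irreducible modulo `p` and takes the value `2 - a`, a square, at `γ₁` and `γ₂`. Otherwise
its factors are `x + a ∓ c`, with values `-(2 ± c)` at `γ₁` and `2 ∓ c` at `γ₂`; since `-1`,
the sum `(2 - c) + (2 + c)` and the product `(2 - c)(2 + c) = 2 - a` are squares, the four values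
are all squares or all nonsquares.

For the groups, let `K_0 = 1` and let `K_(n+1)` be generated by `K_n × K_n` and
`(x_n, x_n) = x_(n+1)²`. Every element of `x_n K_n` is a single cycle, whereas for `n ≥ 2` every
element of `x_n m_n K_n` has at least two cycles. As `N_n = K_n ∪ m_n K_n`, this gives
`N_n^od = K_n` and `M_n(2) = K_n ∪ x_n m_n K_n`. A random element of `K_(n+1)` is, with probability
`1/2` each, a pair of independent random elements of `K_n` or a pair of cycles of length `2^n`:
these are the two transitions of `[ss,d]` in the Markov process, so `K_n` realizes the
descendants of `[ss,1]`. The cycle lengths in the coset `x_n m_n K_n` are twice those in `K_(n-1)`,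
and this gives the descendants of `[ss,2]`.
-/

namespace EvenMarkov

/-! ### Reduction of `g_a` modulo primes -/

theorem postcrit_one (a : ℤ) : postcrit a 1 = -a - 2 := by
  simp [postcrit, gPoly]

theorem postcrit_two (a : ℤ) : postcrit a 2 = 2 - a := by
  simp only [postcrit, gPoly, Function.iterate_succ, Function.iterate_zero, Function.comp, id,
    eval_sub, eval_pow, eval_add, eval_X, eval_C, eval_ofNat]
  ring

theorem gPoly_map (a : ℤ) (p : ℕ) :
    (gPoly a).map (Int.castRingHom (ZMod p)) =
      (X + C (a : ZMod p)) ^ 2 - C ((a : ZMod p) + 2) := by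
  have C_two : (2 : (ZMod p)[X]) = C 2 := rfl
  simp [gPoly, sub_sub, C_two]

section CommRing

variable {R : Type*} [CommRing R]

theorem isSquare_neg_iff (hneg : IsSquare (-1 : R)) (u : R) : IsSquare (-u) ↔ IsSquare u :=
  ⟨fun h => by simpa using hneg.mul h, fun h => by simpa using hneg.mul h⟩

variable [Nontrivial R]

theorem natDegree_sq_sub_C (a c : R) : ((X + C a) ^ 2 - C c).natDegree = 2 := by
  rw [natDegree_sub_C, (monic_X_add_C a).natDegree_pow, natDegree_X_add_C]

theorem monic_sq_sub_C (a c : R) : ((X + C a) ^ 2 - C c).Monic :=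
  ((monic_X_add_C a).pow 2).sub_of_left <|
    degree_C_le.trans_lt <| natDegree_pos_iff_degree_pos.1 <| by
      rw [(monic_X_add_C a).natDegree_pow, natDegree_X_add_C, mul_one]
      exact two_pos

end CommRing

section Field

variable {F : Type*} [Field F]

theorem irreducible_sq_sub_C (a : F) {c : F} (hc : ¬IsSquare c) :
    Irreducible ((X + C a) ^ 2 - C c) := by
  rw [irreducible_iff_roots_eq_zero_of_degree_le_three (natDegree_sq_sub_C a c).ge
    (by rw [natDegree_sq_sub_C]; norm_num), Multiset.eq_zero_iff_forall_notMem]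
  intro z hz
  have hroot := isRoot_of_mem_roots hz
  simp only [IsRoot, eval_sub, eval_pow, eval_add, eval_X, eval_C] at hroot
  exact hc ⟨z + a, by linear_combination -hroot⟩

theorem normalizedFactors_sq_sub_C_of_not_isSquare [DecidableEq F] (a : F) {c : F}
    (hc : ¬IsSquare c) :
    UniqueFactorizationMonoid.normalizedFactors ((X + C a) ^ 2 - C c) =
      {(X + C a) ^ 2 - C c} := by
  rw [UniqueFactorizationMonoid.normalizedFactors_irreducible (irreducible_sq_sub_C a hc),
    (monic_sq_sub_C a c).normalize_eq_self]

theorem normalizedFactors_sq_sub_C_mul_self [DecidableEq F] (a c : F) :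
    UniqueFactorizationMonoid.normalizedFactors ((X + C a) ^ 2 - C (c * c)) =
      {X - C (c - a), X - C (-c - a)} := by
  have factorization : (X + C a) ^ 2 - C (c * c) = (X - C (c - a)) * (X - C (-c - a)) := by
    simp only [C_mul, C_sub, C_neg]
    ring
  rw [factorization, UniqueFactorizationMonoid.normalizedFactors_mul (X_sub_C_ne_zero _)
    (X_sub_C_ne_zero _), UniqueFactorizationMonoid.normalizedFactors_irreducible
    (irreducible_X_sub_C _), UniqueFactorizationMonoid.normalizedFactors_irreducible
    (irreducible_X_sub_C _), (monic_X_sub_C _).normalize_eq_self,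
    (monic_X_sub_C _).normalize_eq_self, Multiset.singleton_add, Multiset.insert_eq_cons]

theorem isSquare_of_isSquare_add_of_isSquare_mul {u v : F} (hadd : IsSquare (u + v))
    (hmul : IsSquare (u * v)) (hu : IsSquare u) : IsSquare v := by
  rcases eq_or_ne u 0 with rfl | hu₀
  · rwa [zero_add] at hadd
  · simpa [hu₀] using hmul.div hu

theorem isSquare_iff_of_isSquare_add_of_isSquare_mul {u v : F} (hadd : IsSquare (u + v))
    (hmul : IsSquare (u * v)) : IsSquare u ↔ IsSquare v :=
  ⟨isSquare_of_isSquare_add_of_isSquare_mul hadd hmul,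
    isSquare_of_isSquare_add_of_isSquare_mul (add_comm u v ▸ hadd) (mul_comm u v ▸ hmul)⟩

theorem isSquare_two_sub_iff_isSquare_two_add {a c : F} (hγ : IsSquare (2 - a))
    (hc : a + 2 = c * c) : IsSquare (2 - c) ↔ IsSquare (2 + c) :=
  isSquare_iff_of_isSquare_add_of_isSquare_mul ⟨2, by ring⟩
    (by rwa [show (2 - c) * (2 + c) = 2 - a by linear_combination hc])

end Field

section FactorizationType

variable {a : ℤ} {p : ℕ} [Fact p.Prime]

theorem factType_of_not_isSquare (hγ : IsSquare (2 - a : ZMod p))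
    (hc : ¬IsSquare (a + 2 : ZMod p)) : factType a p = {(ss, 2)} := by
  have type_eq : typeOf a p ((X + C (a : ZMod p)) ^ 2 - C ((a : ZMod p) + 2)) = ss := by
    have hγ₁ : (-(a : ZMod p) - 2 + a) ^ 2 - (a + 2) = 2 - a := by ring
    have hγ₂ : (2 : ZMod p) ^ 2 - (a + 2) = 2 - a := by ring
    simp [typeOf, postcrit_one, postcrit_two, hγ₁, hγ₂, hγ, ss]
  rw [factType, gPoly_map, normalizedFactors_sq_sub_C_of_not_isSquare _ hc,
    Multiset.map_singleton, type_eq, natDegree_sq_sub_C]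

open Classical in
theorem typeOf_X_sub_C (hneg : IsSquare (-1 : ZMod p)) (hγ : IsSquare (2 - a : ZMod p))
    {c : ZMod p} (hc : (a : ZMod p) + 2 = c * c) :
    typeOf a p (X - C (c - a)) = if IsSquare (2 + c) then ss else nn := by
  have hγ₁ : -(a : ZMod p) - 2 - (c - a) = -(2 + c) := by ring
  have hγ₂ : (2 : ZMod p) - a - (c - a) = 2 - c := by ring
  have heval : typeOf a p (X - C (c - a)) =
      (decide (IsSquare (-(2 + c))), decide (IsSquare (2 - c))) := by
    rw [← hγ₁, ← hγ₂]
    simp [typeOf, postcrit_one, postcrit_two]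
  rw [heval]
  simp only [isSquare_neg_iff hneg, isSquare_two_sub_iff_isSquare_two_add hγ hc]
  split_ifs with h <;> simp [h, ss, nn]

open Classical in
theorem factType_of_eq_mul_self (hneg : IsSquare (-1 : ZMod p)) (hγ : IsSquare (2 - a : ZMod p))
    {c : ZMod p} (hc : (a : ZMod p) + 2 = c * c) :
    factType a p =
      if IsSquare (2 + c) then {(ss, 1), (ss, 1)} else {(nn, 1), (nn, 1)} := by
  have hc' : (a : ZMod p) + 2 = -c * -c := by rw [hc, neg_mul_neg]
  have hconj : IsSquare (2 + -c) ↔ IsSquare (2 + c) := by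
    rw [← sub_eq_add_neg, isSquare_two_sub_iff_isSquare_two_add hγ hc]
  rw [factType, gPoly_map, hc, normalizedFactors_sq_sub_C_mul_self, Multiset.insert_eq_cons,
    Multiset.map_cons, Multiset.map_singleton, typeOf_X_sub_C hneg hγ hc,
    typeOf_X_sub_C hneg hγ hc', natDegree_X_sub_C, natDegree_X_sub_C]
  simp only [hconj]
  split_ifs <;> rfl

theorem factType_mem_firstLevel (hneg : IsSquare (-1 : ZMod p))
    (hγ : IsSquare (2 - a : ZMod p)) :
    ∃ D ∈ firstLevel, factType a p = (D : Multiset (FType × ℕ)) := by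
  classical
  by_cases hc : IsSquare (a + 2 : ZMod p)
  · obtain ⟨c, hc⟩ := hc
    rw [factType_of_eq_mul_self hneg hγ hc]
    split_ifs
    · exact ⟨[(ss, 1), (ss, 1)], by simp [firstLevel], rfl⟩
    · exact ⟨[(nn, 1), (nn, 1)], by simp [firstLevel], rfl⟩
  · exact ⟨[(ss, 2)], by simp [firstLevel], factType_of_not_isSquare hγ hc⟩

end FactorizationType

theorem isSquare_two_sub_cast {R : Type*} [CommRing R] (hneg : IsSquare (-1 : R)) {a b : ℤ}
    (hab : a = 2 + b ^ 2 ∨ a = 2 - b ^ 2) : IsSquare (2 - a : R) := by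
  rcases hab with rfl | rfl
  · simpa using hneg.mul (IsSquare.sq (b : R))
  · simpa using IsSquare.sq (b : R)

/-! ### Cycle types as multisets of orbit sizes -/

section OrbitMap

variable {α β κ ι : Type*}

/-- `f` exhibits `κ` as the set of orbits of `w`: its fibres are exactly the orbits. -/
def IsOrbitMap (w : Equiv.Perm α) (f : α → κ) : Prop :=
  Function.Surjective f ∧ ∀ i j, f i = f j ↔ w.SameCycle i j

theorem isOrbitMap_quotient (w : Equiv.Perm α) :
    IsOrbitMap w (Quotient.mk (Equiv.Perm.SameCycle.setoid w)) :=
  ⟨Quotient.mk_surjective, fun _ _ => Quotient.eq⟩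

theorem sameCycle_permCongr (e : α ≃ β) (w : Equiv.Perm α) (i j : β) :
    (e.permCongr w).SameCycle i j ↔ w.SameCycle (e.symm i) (e.symm j) := by
  have zpow_permCongr (k : ℤ) : e.permCongr w ^ k = e.permCongr (w ^ k) :=
    (map_zpow e.permCongrHom w k).symm
  simp only [Equiv.Perm.SameCycle, zpow_permCongr, Equiv.permCongr_apply, ← e.eq_symm_apply]

theorem zpow_sumCongr (u : Equiv.Perm α) (v : Equiv.Perm β) (k : ℤ) :
    (Equiv.sumCongr u v : Equiv.Perm (α ⊕ β)) ^ k = Equiv.sumCongr (u ^ k) (v ^ k) :=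
  (map_zpow (Equiv.Perm.sumCongrHom α β) (u, v) k).symm

theorem IsOrbitMap.permCongr (e : α ≃ β) {w : Equiv.Perm α} {f : α → κ} (hf : IsOrbitMap w f) :
    IsOrbitMap (e.permCongr w) (f ∘ e.symm) :=
  ⟨hf.1.comp e.symm.surjective, fun i j => by
    rw [Function.comp_apply, Function.comp_apply, hf.2, sameCycle_permCongr]⟩

theorem IsOrbitMap.sumCongr {u : Equiv.Perm α} {v : Equiv.Perm β} {f : α → κ} {g : β → ι}
    (hf : IsOrbitMap u f) (hg : IsOrbitMap v g) :
    IsOrbitMap (Equiv.sumCongr u v : Equiv.Perm (α ⊕ β)) (Sum.map f g) := by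
  refine ⟨hf.1.sumMap hg.1, ?_⟩
  rintro (i | i) (j | j) <;>
    simp [Equiv.Perm.SameCycle, zpow_sumCongr, hf.2, hg.2]

theorem sumCongr_one_mul_sumComm_zpow_two_mul (u : Equiv.Perm α) (k : ℤ) :
    (Equiv.sumCongr u 1 * Equiv.sumComm α α : Equiv.Perm (α ⊕ α)) ^ (2 * k) =
      Equiv.sumCongr (u ^ k) (u ^ k) := by
  have sq_eq : (Equiv.sumCongr u 1 * Equiv.sumComm α α : Equiv.Perm (α ⊕ α)) ^ (2 : ℤ) =
      Equiv.sumCongr u u := by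
    ext (i | i) <;> rfl
  rw [zpow_mul, sq_eq, zpow_sumCongr]

theorem sameCycle_sumCongr_one_mul_sumComm_inl (u : Equiv.Perm α) (i j : α) :
    (Equiv.sumCongr u 1 * Equiv.sumComm α α : Equiv.Perm (α ⊕ α)).SameCycle
      (Sum.inl i) (Sum.inl j) ↔ u.SameCycle i j := by
  constructor
  · rintro ⟨k, hk⟩
    rcases Int.even_or_odd' k with ⟨m, rfl | rfl⟩
    · exact ⟨m, by simpa [sumCongr_one_mul_sumComm_zpow_two_mul] using hk⟩
    · rw [add_comm, zpow_add, Equiv.Perm.mul_apply, sumCongr_one_mul_sumComm_zpow_two_mul] at hk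
      simp at hk
  · rintro ⟨k, hk⟩
    exact ⟨2 * k, by simp [sumCongr_one_mul_sumComm_zpow_two_mul, hk]⟩

theorem IsOrbitMap.sumCongr_one_mul_sumComm {u : Equiv.Perm α} {f : α → κ}
    (hf : IsOrbitMap u f) :
    IsOrbitMap (Equiv.sumCongr u 1 * Equiv.sumComm α α : Equiv.Perm (α ⊕ α)) (Sum.elim f f) := by
  have sameCycle_inr (x : α ⊕ α) (i : α) :
      (Equiv.sumCongr u 1 * Equiv.sumComm α α : Equiv.Perm (α ⊕ α)).SameCycle x (Sum.inr i) ↔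
        (Equiv.sumCongr u 1 * Equiv.sumComm α α : Equiv.Perm (α ⊕ α)).SameCycle x (Sum.inl i) :=
    Equiv.Perm.sameCycle_apply_right (y := Sum.inl i)
  refine ⟨fun k => (hf.1 k).imp' Sum.inl fun _ => id, ?_⟩
  rintro (i | i) (j | j) <;>
    simp only [Sum.elim_inl, Sum.elim_inr, hf.2, sameCycle_inr,
      Equiv.Perm.sameCycle_comm (x := Sum.inr i),
      Equiv.Perm.sameCycle_comm (x := Sum.inl i) (y := Sum.inl _),
      sameCycle_sumCongr_one_mul_sumComm_inl, u.sameCycle_comm]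

/-- The sizes of the fibres of `f`. -/
noncomputable def fiberCards [Fintype κ] (f : α → κ) : Multiset ℕ :=
  Finset.univ.val.map fun k => Nat.card {i // f i = k}

variable [Fintype κ] [Fintype ι]

theorem card_fiberCards (f : α → κ) : (fiberCards f).card = Fintype.card κ :=
  Multiset.card_map _ _

theorem fiberCards_comp_equiv (e : β ≃ α) (f : α → κ) : fiberCards (f ∘ e) = fiberCards f :=
  Multiset.map_congr rfl fun _ _ => Nat.card_congr (e.subtypeEquiv fun _ => Iff.rfl)

theorem fiberCards_sumMap [Finite α] [Finite β] (f : α → κ) (g : β → ι) :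
    fiberCards (Sum.map f g) = fiberCards f + fiberCards g := by
  have card_inl (k : κ) :
      Nat.card {x // Sum.map f g x = Sum.inl k} = Nat.card {i // f i = k} := by
    simp [Nat.card_congr Equiv.subtypeSum]
  have card_inr (l : ι) :
      Nat.card {x // Sum.map f g x = Sum.inr l} = Nat.card {j // g j = l} := by
    simp [Nat.card_congr Equiv.subtypeSum]
  simp only [fiberCards, ← Finset.univ_disjSum_univ, Finset.disjSum, Multiset.disjSum,
    Multiset.map_add, Multiset.map_map, Function.comp_def, card_inl, card_inr]

theorem fiberCards_sumElim_self [Finite α] (f : α → κ) :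
    fiberCards (Sum.elim f f) = (fiberCards f).map (2 * ·) := by
  rw [fiberCards, fiberCards, Multiset.map_map]
  refine Multiset.map_congr rfl fun k _ => ?_
  simp [Nat.card_congr Equiv.subtypeSum, two_mul]

omit [Fintype κ] in
theorem IsOrbitMap.card_fiber_of_isFixedPt {w : Equiv.Perm α} {f : α → κ} (hf : IsOrbitMap w f)
    {i : α} (hi : Function.IsFixedPt w i) : Nat.card {j // f j = f i} = 1 := by
  have fiber_iff (j : α) : f j = f i ↔ j = i := by
    rw [hf.2]
    exact ⟨fun h => h.eq_of_right hi, fun h => h ▸ .refl _ _⟩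
  simp [fiber_iff]

variable [Fintype α] [DecidableEq α] {w : Equiv.Perm α} {f : α → κ}

omit [Fintype κ] in
theorem IsOrbitMap.card_fiber_of_mem_support (hf : IsOrbitMap w f) {i : α}
    (hi : i ∈ w.support) : Nat.card {j // f j = f i} = (w.cycleOf i).support.card := by
  have fiber_iff (j : α) : f j = f i ↔ j ∈ (w.cycleOf i).support := by
    rw [eq_comm, hf.2, Equiv.Perm.mem_support_cycleOf_iff' (Equiv.Perm.mem_support.1 hi)]
  simp only [fiber_iff, Nat.card_eq_fintype_card, Fintype.card_coe]

theorem IsOrbitMap.cycleType_eq (hf : IsOrbitMap w f) {g : κ → α}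
    (hg : Function.RightInverse g f) :
    w.cycleType = (Finset.univ.val.filter (g · ∈ w.support)).map
      fun k => Nat.card {i // f i = k} := by
  classical
  have cycleFactors_eq : w.cycleFactorsFinset =
      (Finset.univ.filter (g · ∈ w.support)).image fun k => w.cycleOf (g k) := by
    ext c
    simp only [Finset.mem_image, Finset.mem_filter_univ]
    constructor
    · intro hc
      obtain ⟨i, hi⟩ := (Equiv.Perm.mem_cycleFactorsFinset_iff.1 hc).1.nonempty_support
      have same : w.SameCycle (g (f i)) i := (hf.2 _ _).1 (hg (f i))
      have hiw := Equiv.Perm.mem_cycleFactorsFinset_support_le hc hi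
      exact ⟨f i, same.mem_support_iff.2 hiw,
        by rw [same.cycleOf_eq, Equiv.Perm.cycle_is_cycleOf hi hc]⟩
    · rintro ⟨k, hk, rfl⟩
      exact Equiv.Perm.cycleOf_mem_cycleFactorsFinset_iff.2 hk
  have cycleOf_injOn : Set.InjOn (fun k => w.cycleOf (g k))
      (Finset.univ.filter (g · ∈ w.support) : Finset κ) := by
    intro k hk l hl hkl
    simp only [Finset.coe_filter, Finset.mem_univ, true_and, Set.mem_ofPred_eq] at hk hl
    rw [← hg k, ← hg l, hf.2]
    exact (Equiv.Perm.sameCycle_iff_cycleOf_eq_of_mem_support hk hl).2 hkl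
  rw [Equiv.Perm.cycleType_def, cycleFactors_eq, Finset.image_val_of_injOn cycleOf_injOn,
    Multiset.map_map, Finset.filter_val]
  refine Multiset.map_congr rfl fun k hk => ?_
  conv_rhs => rw [← hg k]
  exact (hf.card_fiber_of_mem_support (Multiset.mem_filter.1 hk).2).symm

theorem IsOrbitMap.replicate_card_compl_support_eq (hf : IsOrbitMap w f) {g : κ → α}
    (hg : Function.RightInverse g f) :
    Multiset.replicate w.supportᶜ.card 1 = (Finset.univ.val.filter (g · ∉ w.support)).map
      fun k => Nat.card {i // f i = k} := by
  have card_eq : w.supportᶜ.card = (Finset.univ.filter (g · ∉ w.support)).card := by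
    have section_eq {i : α} (hi : i ∈ w.supportᶜ) : g (f i) = i :=
      ((hf.2 _ _).1 (hg (f i))).eq_of_right <|
        Equiv.Perm.notMem_support.1 (Finset.mem_compl.1 hi)
    refine Finset.card_nbij' f g (fun i hi => ?_) (fun k hk => ?_) (fun _ => section_eq)
      fun k _ => hg k
    · simpa [section_eq hi] using hi
    · simpa using hk
  rw [card_eq, Finset.card_def, Finset.filter_val, ← Multiset.map_const']
  refine Multiset.map_congr rfl fun k hk => ?_
  conv_rhs => rw [← hg k]
  exact (hf.card_fiber_of_isFixedPt
    (Equiv.Perm.notMem_support.1 (Multiset.mem_filter.1 hk).2)).symm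

theorem IsOrbitMap.parts_partition (hf : IsOrbitMap w f) :
    w.partition.parts = fiberCards f := by
  obtain ⟨g, hg⟩ := hf.1.hasRightInverse
  rw [Equiv.Perm.parts_partition, ← Finset.card_compl, hf.cycleType_eq hg,
    hf.replicate_card_compl_support_eq hg, ← Multiset.map_add, Multiset.filter_add_not, fiberCards]

theorem parts_partition_permCongr [Fintype β] [DecidableEq β] (e : α ≃ β) (w : Equiv.Perm α) :
    (e.permCongr w).partition.parts = w.partition.parts := by
  classical
  rw [(isOrbitMap_quotient w).parts_partition,
    ((isOrbitMap_quotient w).permCongr e).parts_partition, fiberCards_comp_equiv]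

theorem parts_partition_sumCongr [Fintype β] [DecidableEq β] (u : Equiv.Perm α)
    (v : Equiv.Perm β) :
    (Equiv.Perm.partition (Equiv.sumCongr u v)).parts = u.partition.parts + v.partition.parts := by
  classical
  rw [((isOrbitMap_quotient u).sumCongr (isOrbitMap_quotient v)).parts_partition,
    fiberCards_sumMap, (isOrbitMap_quotient u).parts_partition,
    (isOrbitMap_quotient v).parts_partition]

theorem parts_partition_sumCongr_one_mul_sumComm (u : Equiv.Perm α) :
    (Equiv.Perm.partition (Equiv.sumCongr u 1 * Equiv.sumComm α α)).parts =
      u.partition.parts.map (2 * ·) := by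
  classical
  rw [(isOrbitMap_quotient u).sumCongr_one_mul_sumComm.parts_partition, fiberCards_sumElim_self,
    (isOrbitMap_quotient u).parts_partition]

theorem card_parts_partition_eq_one_iff [Nonempty α] (w : Equiv.Perm α) :
    w.partition.parts.card = 1 ↔ ∀ i j, w.SameCycle i j := by
  classical
  have hw := isOrbitMap_quotient w
  rw [hw.parts_partition, card_fiberCards, ← Nat.card_eq_fintype_card,
    Nat.card_eq_one_iff_unique]
  refine ⟨fun ⟨_, _⟩ i j => (hw.2 i j).1 (Subsingleton.elim _ _),
    fun h => ⟨⟨?_⟩, (nonempty_quotient_iff _).2 inferInstance⟩⟩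
  exact hw.1.forall₂.2 fun i j => (hw.2 i j).2 (h i j)

end OrbitMap

/-! ### The two halves of the tree -/

/-- The leaves of `T_(n+1)` are the leaves of its two subtrees of height `n`. -/
def leafEquiv (n : ℕ) : Fin (2 ^ n) ⊕ Fin (2 ^ n) ≃ Fin (2 ^ (n + 1)) :=
  finSumFinEquiv.trans (finCongr (by rw [pow_succ]; ring))

theorem leafEquiv_inl_val {n : ℕ} (i : Fin (2 ^ n)) : (leafEquiv n (Sum.inl i) : ℕ) = i := rfl

theorem leafEquiv_inr_val {n : ℕ} (i : Fin (2 ^ n)) :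
    (leafEquiv n (Sum.inr i) : ℕ) = 2 ^ n + i := rfl

/-- The embedding `Aut(T_n) × Aut(T_n) → Aut(T_(n+1))`, the two factors acting on the left and on
the right subtree, as a homomorphism of the ambient symmetric groups. -/
def pairHom (n : ℕ) :
    Equiv.Perm (Fin (2 ^ n)) × Equiv.Perm (Fin (2 ^ n)) →* Equiv.Perm (Fin (2 ^ (n + 1))) :=
  (leafEquiv n).permCongrHom.toMonoidHom.comp (Equiv.Perm.sumCongrHom _ _)

/-- The permutation acting as `u` on the left subtree and as `v` on the right subtree; in the
usual wreath product notation, `(u, v)`. -/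
def pair {n : ℕ} (u v : Equiv.Perm (Fin (2 ^ n))) : Equiv.Perm (Fin (2 ^ (n + 1))) :=
  pairHom n (u, v)

/-- The exchange of the two subtrees of `T_(n+1)`. -/
def halfSwap (n : ℕ) : Equiv.Perm (Fin (2 ^ (n + 1))) :=
  (leafEquiv n).permCongr (Equiv.sumComm _ _)

section Pair

variable {n : ℕ} (u v u' v' : Equiv.Perm (Fin (2 ^ n)))

theorem pair_leafEquiv (x : Fin (2 ^ n) ⊕ Fin (2 ^ n)) :
    pair u v (leafEquiv n x) = leafEquiv n (x.map u v) :=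
  congrArg (leafEquiv n ∘ Sum.map u v) ((leafEquiv n).symm_apply_apply x)

theorem halfSwap_leafEquiv (x : Fin (2 ^ n) ⊕ Fin (2 ^ n)) :
    halfSwap n (leafEquiv n x) = leafEquiv n x.swap :=
  congrArg (leafEquiv n ∘ Sum.swap) ((leafEquiv n).symm_apply_apply x)

theorem perm_ext_leafEquiv {w w' : Equiv.Perm (Fin (2 ^ (n + 1)))}
    (h : ∀ x, w (leafEquiv n x) = w' (leafEquiv n x)) : w = w' :=
  Equiv.ext ((leafEquiv n).surjective.forall.2 h)

theorem pair_mul : pair u v * pair u' v' = pair (u * u') (v * v') :=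
  (map_mul (pairHom n) (u, v) (u', v')).symm

theorem pair_one : pair (1 : Equiv.Perm (Fin (2 ^ n))) 1 = 1 := map_one (pairHom n)

theorem pair_inv : (pair u v)⁻¹ = pair u⁻¹ v⁻¹ := (map_inv (pairHom n) (u, v)).symm

theorem halfSwap_mul_self : halfSwap n * halfSwap n = 1 :=
  perm_ext_leafEquiv fun x => by simp [halfSwap_leafEquiv]

theorem halfSwap_inv : (halfSwap n)⁻¹ = halfSwap n :=
  inv_eq_of_mul_eq_one_left halfSwap_mul_self

theorem halfSwap_mul_pair : halfSwap n * pair u v = pair v u * halfSwap n :=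
  perm_ext_leafEquiv <| by rintro (i | i) <;> simp [pair_leafEquiv, halfSwap_leafEquiv]

theorem halfSwap_mul_pair_mul (w : Equiv.Perm (Fin (2 ^ (n + 1)))) :
    halfSwap n * (pair u v * w) = pair v u * (halfSwap n * w) := by
  rw [← mul_assoc, halfSwap_mul_pair, mul_assoc]

theorem halfSwap_mul_halfSwap_mul (w : Equiv.Perm (Fin (2 ^ (n + 1)))) :
    halfSwap n * (halfSwap n * w) = w := by
  rw [← mul_assoc, halfSwap_mul_self, one_mul]

end Pair

/-! ### The generators in terms of the two halves -/

theorem genA_val {n i : ℕ} (h : 1 ≤ i ∧ i ≤ n) (j : Fin (2 ^ n)) :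
    (genA n i j : ℕ) = if (j : ℕ) < 2 ^ (i - 1) then (j : ℕ) + 2 ^ (i - 1)
      else if (j : ℕ) < 2 ^ i then (j : ℕ) - 2 ^ (i - 1) else j := by
  rw [genA, dif_pos h, Function.Involutive.coe_toPerm, exchange]
  split_ifs <;> rfl

theorem genA_succ_self (n : ℕ) : genA (n + 1) (n + 1) = halfSwap n := by
  have hpow : 2 ^ n + 2 ^ n = 2 ^ (n + 1) := by ring
  refine perm_ext_leafEquiv ?_
  rintro (i | i) <;> apply Fin.ext <;> have hi := i.isLt <;>
    rw [genA_val (by omega), halfSwap_leafEquiv, Nat.add_sub_cancel]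
  · rw [Sum.swap_inl, leafEquiv_inl_val, leafEquiv_inr_val, if_pos hi, add_comm]
  · rw [Sum.swap_inr, leafEquiv_inl_val, leafEquiv_inr_val, if_neg (by omega),
      if_pos (hpow ▸ Nat.add_lt_add_left hi _), Nat.add_sub_cancel_left]

theorem genA_succ_of_le {n i : ℕ} (hi : i ≤ n) : genA (n + 1) i = pair (genA n i) 1 := by
  rcases Nat.eq_zero_or_pos i with rfl | hpos
  · rw [genA, dif_neg (by omega), genA, dif_neg (by omega), pair_one]
  have hlow : 2 ^ (i - 1) ≤ 2 ^ n := Nat.pow_le_pow_right two_pos (by omega)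
  have hhigh : 2 ^ i ≤ 2 ^ n := Nat.pow_le_pow_right two_pos hi
  refine perm_ext_leafEquiv ?_
  rintro (j | j) <;> apply Fin.ext <;> rw [genA_val ⟨hpos, by omega⟩, pair_leafEquiv]
  · rw [Sum.map_inl, leafEquiv_inl_val, leafEquiv_inl_val, genA_val ⟨hpos, hi⟩]
  · rw [Sum.map_inr, Equiv.Perm.one_apply, leafEquiv_inr_val, if_neg (by omega),
      if_neg (by omega)]

theorem odo_succ_of_le {n i : ℕ} (hi : i ≤ n) : odo (n + 1) i = pair (odo n i) 1 := by
  induction i with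
  | zero => exact pair_one.symm
  | succ i ih => rw [odo, odo, ih (by omega), genA_succ_of_le hi, pair_mul, one_mul]

theorem odo_succ_self (n : ℕ) : odo (n + 1) (n + 1) = pair (odo n n) 1 * halfSwap n := by
  rw [odo, odo_succ_of_le le_rfl, genA_succ_self]

theorem pair_odo_one (n : ℕ) : pair (odo n n) 1 = odo (n + 1) (n + 1) * halfSwap n := by
  rw [odo_succ_self, mul_assoc, halfSwap_mul_self, mul_one]

theorem odo_succ_self_sq (n : ℕ) :
    odo (n + 1) (n + 1) ^ 2 = pair (odo n n) (odo n n) := by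
  rw [sq, odo_succ_self, mul_assoc, halfSwap_mul_pair_mul, halfSwap_mul_self, mul_one, pair_mul,
    one_mul, mul_one]

theorem odo_conj_pair {n : ℕ} (u v : Equiv.Perm (Fin (2 ^ n))) :
    odo (n + 1) (n + 1) * pair u v * (odo (n + 1) (n + 1))⁻¹ =
      pair (odo n n * v * (odo n n)⁻¹) u := by
  simp only [odo_succ_self, mul_inv_rev, pair_inv, halfSwap_inv, mul_assoc, halfSwap_mul_pair_mul,
    halfSwap_mul_halfSwap_mul, pair_mul, one_mul, inv_one, mul_one]

theorem vElt_succ_of_le {n i : ℕ} (hi : i + 2 ≤ n) : vElt (n + 1) i = pair (vElt n i) 1 := by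
  rw [vElt, odo_succ_of_le hi, sq, pair_mul, vElt, sq, one_mul]

theorem mElt_add_two (n : ℕ) :
    mElt (n + 2) = pair (halfSwap n) (odo (n + 1) (n + 1) * halfSwap n) := by
  rw [mElt, odo_succ_of_le (show n ≤ n + 1 by omega), odo_conj_pair,
    genA_succ_of_le (le_refl (n + 1)), genA_succ_self, pair_mul, mul_one, mul_inv_cancel, mul_one,
    one_mul, odo_succ_of_le (le_refl n), pair_odo_one]

/-! ### Tree automorphisms -/

theorem leafEquiv_div_eq_iff {n : ℕ} (k : ℕ) (x y : Fin (2 ^ n) ⊕ Fin (2 ^ n)) :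
    (leafEquiv n x : ℕ) / 2 ^ k = (leafEquiv n y : ℕ) / 2 ^ k ↔
      n < k ∨ Sum.LiftRel (fun i j : Fin (2 ^ n) => (i : ℕ) / 2 ^ k = (j : ℕ) / 2 ^ k)
        (fun i j : Fin (2 ^ n) => (i : ℕ) / 2 ^ k = (j : ℕ) / 2 ^ k) x y := by
  rcases lt_or_ge n k with hk | hk
  · have root (i : Fin (2 ^ (n + 1))) : (i : ℕ) / 2 ^ k = 0 :=
      Nat.div_eq_of_lt (i.isLt.trans_le (Nat.pow_le_pow_right two_pos hk))
    simp only [root, hk, true_or]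
  · have hpow : 2 ^ n = 2 ^ (n - k) * 2 ^ k := by rw [← pow_add, Nat.sub_add_cancel hk]
    have left_lt (i : Fin (2 ^ n)) : (i : ℕ) / 2 ^ k < 2 ^ (n - k) :=
      Nat.div_lt_of_lt_mul (by rw [mul_comm, ← hpow]; exact i.isLt)
    have right_eq (i : ℕ) : (2 ^ n + i) / 2 ^ k = 2 ^ (n - k) + i / 2 ^ k := by
      rw [hpow, add_comm, Nat.add_mul_div_right _ _ (by positivity), add_comm]
    rcases x with i | i <;> rcases y with j | j <;>
      simp only [leafEquiv_inl_val, leafEquiv_inr_val, right_eq, hk.not_gt, false_or,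
        Sum.liftRel_inl_inl, Sum.liftRel_inr_inr, Sum.not_liftRel_inl_inr,
        Sum.not_liftRel_inr_inl, Nat.add_left_cancel_iff, iff_false]
    · exact (Nat.lt_add_right _ (left_lt i)).ne
    · exact (Nat.lt_add_right _ (left_lt j)).ne'

theorem pair_mem_treeAut {n : ℕ} {u v : Equiv.Perm (Fin (2 ^ n))} (hu : u ∈ treeAut n)
    (hv : v ∈ treeAut n) : pair u v ∈ treeAut (n + 1) := by
  intro k
  refine (leafEquiv n).surjective.forall₂.2 fun x y => ?_
  rw [pair_leafEquiv, pair_leafEquiv, leafEquiv_div_eq_iff, leafEquiv_div_eq_iff]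
  rcases x with i | i <;> rcases y with j | j <;> simp [hu k i j, hv k i j]

theorem halfSwap_mem_treeAut (n : ℕ) : halfSwap n ∈ treeAut (n + 1) := by
  intro k
  refine (leafEquiv n).surjective.forall₂.2 fun x y => ?_
  rw [halfSwap_leafEquiv, halfSwap_leafEquiv, leafEquiv_div_eq_iff, leafEquiv_div_eq_iff,
    Sum.liftRel_swap_iff]

theorem genA_mem_treeAut (n i : ℕ) : genA n i ∈ treeAut n := by
  induction n with
  | zero => rw [genA, dif_neg (by omega)]; exact one_mem _
  | succ n ih =>
    rcases lt_trichotomy i (n + 1) with hi | rfl | hi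
    · rw [genA_succ_of_le (by omega)]
      exact pair_mem_treeAut ih (one_mem _)
    · rw [genA_succ_self]
      exact halfSwap_mem_treeAut n
    · rw [genA, dif_neg (by omega)]
      exact one_mem _

theorem odo_mem_treeAut (n i : ℕ) : odo n i ∈ treeAut n := by
  induction i with
  | zero => exact one_mem _
  | succ i ih => exact mul_mem ih (genA_mem_treeAut n _)

theorem mElt_mem_treeAut : ∀ n, mElt n ∈ treeAut n
  | 0 => one_mem _
  | 1 => one_mem _
  | _ + 2 => mul_mem (genA_mem_treeAut _ _) (mul_mem (mul_mem (odo_mem_treeAut _ _)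
      (odo_mem_treeAut _ _)) (inv_mem (odo_mem_treeAut _ _)))

theorem grpM_le_treeAut (n : ℕ) : grpM n ≤ treeAut n := by
  rw [grpM, Subgroup.closure_le]
  rintro w ((rfl | rfl) | ⟨i, -, rfl⟩)
  · exact odo_mem_treeAut n n
  · exact mElt_mem_treeAut n
  · exact pow_mem (odo_mem_treeAut n _) 2

theorem grpN_le_grpM (n : ℕ) : grpN n ≤ grpM n := by
  rw [grpN]
  exact Subgroup.map_subtype_le _

theorem odo_mem_grpM (n : ℕ) : odo n n ∈ grpM n :=
  Subgroup.subset_closure (Or.inl (Or.inl rfl))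

theorem grpM2_le_treeAut (n : ℕ) : grpM2 n ≤ treeAut n := by
  rw [grpM2, Subgroup.closure_le]
  rintro w (rfl | hw)
  · exact mul_mem (odo_mem_treeAut n n) (mElt_mem_treeAut n)
  · exact grpM_le_treeAut n (grpN_le_grpM n hw.1)

/-! ### Cycle types and the two halves -/

theorem cyc_pair {n : ℕ} (u v : Equiv.Perm (Fin (2 ^ n))) :
    cyc (pair u v) = cyc u + cyc v := by
  rw [cyc, cyc, cyc, ← parts_partition_sumCongr]
  exact parts_partition_permCongr _ _

theorem cyc_pair_mul_halfSwap {n : ℕ} (u v : Equiv.Perm (Fin (2 ^ n))) :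
    cyc (pair u v * halfSwap n) = (cyc (u * v)).map (2 * ·) := by
  have hconj : IsConj (pair u v * halfSwap n) (pair (u * v) 1 * halfSwap n) := by
    refine isConj_iff.2 ⟨pair 1 v⁻¹, ?_⟩
    simp only [pair_inv, mul_assoc, halfSwap_mul_pair, pair_mul, ← mul_assoc (pair _ _), one_mul,
      inv_one, inv_inv, mul_one, inv_mul_cancel]
  rw [cyc, cyc, Equiv.Perm.partition_eq_of_isConj.1 hconj,
    ← parts_partition_sumCongr_one_mul_sumComm, ← parts_partition_permCongr (leafEquiv n),
    Equiv.permCongr_mul]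
  rfl

theorem cyc_zero (w : Equiv.Perm (Fin (2 ^ 0))) : cyc w = {1} := by
  obtain rfl : w = 1 := Equiv.ext fun i => Subsingleton.elim (α := Fin 1) _ _
  simp [cyc, Equiv.Perm.parts_partition]

theorem card_cyc_pos {n : ℕ} (w : Equiv.Perm (Fin (2 ^ n))) : 0 < (cyc w).card := by
  refine Multiset.card_pos.2 fun h => (Nat.two_pow_pos n).ne ?_
  rw [← Fintype.card_fin (2 ^ n), ← w.partition.parts_sum, show w.partition.parts = 0 from h,
    Multiset.sum_zero]

theorem isOdometer_iff_card_cyc {n : ℕ} (w : Equiv.Perm (Fin (2 ^ n))) :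
    IsOdometer n w ↔ (cyc w).card = 1 :=
  (card_parts_partition_eq_one_iff w).symm

/-! ### Centralizers modulo a subgroup -/

section CentralizerMod

open scoped commutatorElement

variable {G : Type*} [Group G] {K : Subgroup G} {g x y z : G}

theorem conj_mem_of_mem_normalizer (hg : g ∈ Subgroup.normalizer (K : Set G)) {k : G}
    (hk : k ∈ K) : g * k * g⁻¹ ∈ K :=
  (Subgroup.mem_normalizer_iff.1 hg k).1 hk

/-- The elements of the normalizer of `K` that commute with `x` modulo `K`: when `x` normalizes
`K`, the preimage in the normalizer of the centralizer of the class of `x`. -/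
def centralizerMod (K : Subgroup G) (x : G) : Subgroup G where
  carrier := {g | g ∈ Subgroup.normalizer (K : Set G) ∧ ⁅g, x⁆ ∈ K}
  one_mem' := ⟨one_mem _, by simp⟩
  mul_mem' := by
    rintro g h ⟨hg, hgx⟩ ⟨hh, hhx⟩
    refine ⟨mul_mem hg hh, ?_⟩
    rw [show ⁅g * h, x⁆ = g * ⁅h, x⁆ * g⁻¹ * ⁅g, x⁆ by simp only [commutatorElement_def]; group]
    exact mul_mem (conj_mem_of_mem_normalizer hg hhx) hgx
  inv_mem' := by
    rintro g ⟨hg, hgx⟩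
    refine ⟨inv_mem hg, ?_⟩
    rw [show ⁅g⁻¹, x⁆ = g⁻¹ * ⁅g, x⁆⁻¹ * g⁻¹⁻¹ by simp only [commutatorElement_def]; group]
    exact conj_mem_of_mem_normalizer (inv_mem hg) (inv_mem hgx)

theorem self_mem_centralizerMod (hx : x ∈ Subgroup.normalizer (K : Set G)) :
    x ∈ centralizerMod K x :=
  ⟨hx, by rw [commutatorElement_self]; exact one_mem K⟩

theorem le_centralizerMod (hx : x ∈ Subgroup.normalizer (K : Set G)) : K ≤ centralizerMod K x := by
  refine fun k hk => ⟨Subgroup.le_normalizer hk, ?_⟩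
  rw [show ⁅k, x⁆ = k * (x * k⁻¹ * x⁻¹) by rw [commutatorElement_def]; group]
  exact mul_mem hk (conj_mem_of_mem_normalizer hx (inv_mem hk))

theorem sup_zpowers_le_centralizerMod (hx : x ∈ Subgroup.normalizer (K : Set G))
    (hg : g ∈ centralizerMod K x) : K ⊔ Subgroup.zpowers x ≤ centralizerMod K g :=
  sup_le (le_centralizerMod hg.1)
    (Subgroup.zpowers_le.2 ⟨hx, commutatorElement_inv g x ▸ inv_mem hg.2⟩)

theorem centralizerMod_le_normalizer_sup (K : Subgroup G) (y : G) :
    centralizerMod K y ≤ Subgroup.normalizer ((K ⊔ Subgroup.zpowers y : Subgroup G) : Set G) := by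
  refine Subgroup.le_normalizer_iff.2 fun g hg => ?_
  change K ⊔ Subgroup.zpowers y ≤ (K ⊔ Subgroup.zpowers y).comap (MulAut.conj g).toMonoidHom
  refine sup_le (fun k hk => Subgroup.mem_sup_left (conj_mem_of_mem_normalizer hg.1 hk))
    (Subgroup.zpowers_le.2 ?_)
  change g * y * g⁻¹ ∈ K ⊔ Subgroup.zpowers y
  rw [show g * y * g⁻¹ = ⁅g, y⁆ * y by rw [commutatorElement_def]; group]
  exact mul_mem (Subgroup.mem_sup_left hg.2) (Subgroup.mem_sup_right (Subgroup.mem_zpowers y))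

theorem mem_sup_zpowers_iff (hy : y ∈ Subgroup.normalizer (K : Set G)) (hyy : y * y ∈ K) :
    z ∈ K ⊔ Subgroup.zpowers y ↔ ∃ b : Bool, ∃ k ∈ K, y ^ b.toNat * k = z := by
  constructor
  · rw [sup_comm, ← SetLike.mem_coe,
      Subgroup.coe_mul_of_left_le_normalizer_right _ _ (Subgroup.zpowers_le.2 hy)]
    rintro ⟨_, ⟨m, rfl⟩, k, hk, rfl⟩
    obtain ⟨j, rfl | rfl⟩ := m.even_or_odd'
    · exact ⟨false, (y * y) ^ j * k, mul_mem (zpow_mem hyy j) hk, by simp [zpow_mul, pow_two]⟩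
    · refine ⟨true, (y * y) ^ j * k, mul_mem (zpow_mem hyy j) hk, ?_⟩
      simp [add_comm (2 * j), zpow_add, zpow_mul, pow_two, mul_assoc]
  · rintro ⟨b, k, hk, rfl⟩
    exact mul_mem (pow_mem (Subgroup.mem_sup_right (Subgroup.mem_zpowers y)) _)
      (Subgroup.mem_sup_left hk)

theorem mul_self_mem_of_mem_sup_zpowers (hy : y ∈ Subgroup.normalizer (K : Set G))
    (hyy : y * y ∈ K) (hz : z ∈ K ⊔ Subgroup.zpowers y) : z * z ∈ K := by
  obtain ⟨b, k, hk, rfl⟩ := (mem_sup_zpowers_iff hy hyy).1 hz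
  have hyb : y ^ b.toNat * y ^ b.toNat ∈ K := by cases b <;> simp [hyy, one_mem]
  rw [show y ^ b.toNat * k * (y ^ b.toNat * k) =
    y ^ b.toNat * k * (y ^ b.toNat)⁻¹ * (y ^ b.toNat * y ^ b.toNat) * k by group]
  exact mul_mem (mul_mem (conj_mem_of_mem_normalizer (pow_mem hy _) hk) hyb) hk

/-- Modulo `K` the product is `c z d z = (c d) z²`. -/
theorem mul_mul_mul_mul_mem {c d v : G} (hc : c ∈ Subgroup.normalizer (K : Set G))
    (hz : z ∈ centralizerMod K d) (hcd : c * d ∈ K) (hzz : z * z ∈ K) (hv : v ∈ K) :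
    c * z * v * d * z ∈ K := by
  rw [show c * z * v * d * z =
    c * z * v * (c * z)⁻¹ * (c * ⁅z, d⁆ * c⁻¹) * (c * d) * (z * z) by
      rw [commutatorElement_def]; group]
  exact mul_mem (mul_mem (mul_mem (conj_mem_of_mem_normalizer (mul_mem hc hz.1) hv)
    (conj_mem_of_mem_normalizer hc hz.2)) hcd) hzz

end CentralizerMod

/-! ### The subgroups `K_n` -/

/-- The product `K × K`, acting on the two subtrees of `T_(n+1)`. -/
def pairSubgroup {n : ℕ} (K : Subgroup (Equiv.Perm (Fin (2 ^ n)))) :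
    Subgroup (Equiv.Perm (Fin (2 ^ (n + 1)))) :=
  (K.prod K).map (pairHom n)

section PairSubgroup

variable {n : ℕ} {K : Subgroup (Equiv.Perm (Fin (2 ^ n)))}

theorem mem_pairSubgroup {w : Equiv.Perm (Fin (2 ^ (n + 1)))} :
    w ∈ pairSubgroup K ↔ ∃ u ∈ K, ∃ v ∈ K, pair u v = w := by
  constructor
  · rintro ⟨⟨u, v⟩, ⟨hu, hv⟩, rfl⟩
    exact ⟨u, hu, v, hv, rfl⟩
  · rintro ⟨u, hu, v, hv, rfl⟩
    exact ⟨(u, v), ⟨hu, hv⟩, rfl⟩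

theorem pair_mem_pairSubgroup {u v : Equiv.Perm (Fin (2 ^ n))} (hu : u ∈ K) (hv : v ∈ K) :
    pair u v ∈ pairSubgroup K :=
  mem_pairSubgroup.2 ⟨u, hu, v, hv, rfl⟩

open scoped commutatorElement in
theorem pair_mem_centralizerMod {c d x : Equiv.Perm (Fin (2 ^ n))} (hc : c ∈ centralizerMod K x)
    (hd : d ∈ centralizerMod K x) : pair c d ∈ centralizerMod (pairSubgroup K) (pair x x) := by
  have hnorm : (c, d) ∈ Subgroup.normalizer ((K.prod K : Subgroup _) : Set (_ × _)) :=
    Subgroup.mem_normalizer_iff.2 fun h => and_congr (Subgroup.mem_normalizer_iff.1 hc.1 h.1)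
      (Subgroup.mem_normalizer_iff.1 hd.1 h.2)
  have hcomm : ⁅pair c d, pair x x⁆ = pair ⁅c, x⁆ ⁅d, x⁆ := by
    simp only [commutatorElement_def, pair_inv, pair_mul]
  exact ⟨Subgroup.le_normalizer_map _ ⟨(c, d), hnorm, rfl⟩,
    hcomm ▸ pair_mem_pairSubgroup hc.2 hd.2⟩

theorem halfSwap_mem_centralizerMod (K : Subgroup (Equiv.Perm (Fin (2 ^ n))))
    (x : Equiv.Perm (Fin (2 ^ n))) :
    halfSwap n ∈ centralizerMod (pairSubgroup K) (pair x x) := by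
  have hconj : ∀ w ∈ pairSubgroup K, halfSwap n * w * (halfSwap n)⁻¹ ∈ pairSubgroup K := by
    rintro _ hw
    obtain ⟨u, hu, v, hv, rfl⟩ := mem_pairSubgroup.1 hw
    rw [halfSwap_mul_pair, mul_inv_cancel_right]
    exact pair_mem_pairSubgroup hv hu
  refine ⟨Subgroup.mem_normalizer_iff.2 fun w => ⟨hconj w, fun hw => ?_⟩, ?_⟩
  · simpa only [halfSwap_inv, mul_assoc, halfSwap_mul_halfSwap_mul, halfSwap_mul_self, mul_one]
      using hconj _ hw
  · rw [commutatorElement_def, halfSwap_mul_pair, mul_inv_cancel_right, mul_inv_cancel]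
    exact one_mem _

end PairSubgroup

/-- The groups `K_n`, which will turn out to be the odometer parts `N_n^od`: `K_0` is trivial, and
`K_(n+1)` is generated by `K_n × K_n` and `(x_n, x_n) = x_(n+1)²`. -/
def grpK : (n : ℕ) → Subgroup (Equiv.Perm (Fin (2 ^ n)))
  | 0 => ⊥
  | n + 1 => pairSubgroup (grpK n) ⊔ Subgroup.zpowers (pair (odo n n) (odo n n))

/-- The group generated by `K_n` and `x_n`. It contains `K_n` with index at most `2`, and the
elements of `K_(n+1)` are the pairs of elements in the same coset. -/
def grpL (n : ℕ) : Subgroup (Equiv.Perm (Fin (2 ^ n))) :=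
  grpK n ⊔ Subgroup.zpowers (odo n n)

theorem odo_mul_odo_mem_grpK : ∀ n, odo n n * odo n n ∈ grpK n
  | 0 => one_mem _
  | n + 1 => by
    rw [← sq, odo_succ_self_sq]
    exact Subgroup.mem_sup_right (Subgroup.mem_zpowers _)

theorem halfSwap_mem_normalizer_grpK (n : ℕ) :
    halfSwap n ∈ Subgroup.normalizer (grpK (n + 1) : Set (Equiv.Perm (Fin (2 ^ (n + 1))))) :=
  centralizerMod_le_normalizer_sup _ _ (halfSwap_mem_centralizerMod _ _)

theorem pair_mem_normalizer_grpK {n : ℕ} {c d : Equiv.Perm (Fin (2 ^ n))}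
    (hc : c ∈ centralizerMod (grpK n) (odo n n)) (hd : d ∈ centralizerMod (grpK n) (odo n n)) :
    pair c d ∈ Subgroup.normalizer (grpK (n + 1) : Set (Equiv.Perm (Fin (2 ^ (n + 1))))) :=
  centralizerMod_le_normalizer_sup _ _ (pair_mem_centralizerMod hc hd)

theorem odo_mem_normalizer_grpK (n : ℕ) :
    odo n n ∈ Subgroup.normalizer (grpK n : Set (Equiv.Perm (Fin (2 ^ n)))) := by
  induction n with
  | zero => exact one_mem _
  | succ n ih =>
    rw [odo_succ_self]
    exact mul_mem (pair_mem_normalizer_grpK (self_mem_centralizerMod ih) (one_mem _))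
      (halfSwap_mem_normalizer_grpK n)

theorem odo_mem_centralizerMod_grpK (n : ℕ) : odo n n ∈ centralizerMod (grpK n) (odo n n) :=
  self_mem_centralizerMod (odo_mem_normalizer_grpK n)

theorem grpL_le_centralizerMod {n : ℕ} {d : Equiv.Perm (Fin (2 ^ n))}
    (hd : d ∈ centralizerMod (grpK n) (odo n n)) : grpL n ≤ centralizerMod (grpK n) d :=
  sup_zpowers_le_centralizerMod (odo_mem_normalizer_grpK n) hd

theorem pair_mem_grpK {n : ℕ} {u v : Equiv.Perm (Fin (2 ^ n))} (hu : u ∈ grpK n)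
    (hv : v ∈ grpK n) : pair u v ∈ grpK (n + 1) :=
  Subgroup.mem_sup_left (pair_mem_pairSubgroup hu hv)

theorem pair_odo_mul_mem_grpK {n : ℕ} {u v : Equiv.Perm (Fin (2 ^ n))} (hu : u ∈ grpK n)
    (hv : v ∈ grpK n) : pair (odo n n * u) (odo n n * v) ∈ grpK (n + 1) := by
  rw [← pair_mul]
  exact mul_mem (Subgroup.mem_sup_right (Subgroup.mem_zpowers _)) (pair_mem_grpK hu hv)

theorem pair_pow {n : ℕ} (u v : Equiv.Perm (Fin (2 ^ n))) (k : ℕ) :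
    pair u v ^ k = pair (u ^ k) (v ^ k) :=
  (map_pow (pairHom n) (u, v) k).symm

theorem pair_odo_odo_mem_normalizer (n : ℕ) : pair (odo n n) (odo n n) ∈
    Subgroup.normalizer (pairSubgroup (grpK n) : Set (Equiv.Perm (Fin (2 ^ (n + 1))))) :=
  (pair_mem_centralizerMod (odo_mem_centralizerMod_grpK n) (odo_mem_centralizerMod_grpK n)).1

theorem pair_odo_odo_mul_self_mem (n : ℕ) :
    pair (odo n n) (odo n n) * pair (odo n n) (odo n n) ∈ pairSubgroup (grpK n) := by
  rw [pair_mul]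
  exact pair_mem_pairSubgroup (odo_mul_odo_mem_grpK n) (odo_mul_odo_mem_grpK n)

theorem exists_pair_eq_of_mem_grpK_succ {n : ℕ} {w : Equiv.Perm (Fin (2 ^ (n + 1)))}
    (hw : w ∈ grpK (n + 1)) :
    ∃ z ∈ grpL n, ∃ u ∈ grpK n, ∃ v ∈ grpK n, pair (z * u) (z * v) = w := by
  obtain ⟨b, _, hk, rfl⟩ := (mem_sup_zpowers_iff (pair_odo_odo_mem_normalizer n)
    (pair_odo_odo_mul_self_mem n)).1 hw
  obtain ⟨u, hu, v, hv, rfl⟩ := mem_pairSubgroup.1 hk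
  refine ⟨odo n n ^ b.toNat, pow_mem (Subgroup.mem_sup_right (Subgroup.mem_zpowers _)) _,
    u, hu, v, hv, ?_⟩
  rw [pair_pow, pair_mul]

/-! ### Cycle types in the cosets of `K_n` -/

theorem cyc_pair_mul_halfSwap_mul_pair {n : ℕ} (c d z u v : Equiv.Perm (Fin (2 ^ n))) :
    cyc (pair c d * halfSwap n * pair (z * u) (z * v)) =
      (cyc (c * z * v * d * z * u)).map (2 * ·) := by
  rw [mul_assoc, halfSwap_mul_pair, ← mul_assoc, pair_mul, cyc_pair_mul_halfSwap]
  simp only [mul_assoc]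

theorem mul_mem_grpK_of_mem_grpL {n : ℕ} {c d z v : Equiv.Perm (Fin (2 ^ n))}
    (hc : c ∈ centralizerMod (grpK n) (odo n n)) (hd : d ∈ centralizerMod (grpK n) (odo n n))
    (hcd : c * d ∈ grpK n) (hz : z ∈ grpL n) (hv : v ∈ grpK n) : c * z * v * d * z ∈ grpK n :=
  mul_mul_mul_mul_mem hc.1 (grpL_le_centralizerMod hd hz) hcd
    (mul_self_mem_of_mem_sup_zpowers (odo_mem_normalizer_grpK n) (odo_mul_odo_mem_grpK n) hz) hv

theorem cyc_odo_mul {n : ℕ} {k : Equiv.Perm (Fin (2 ^ n))} (hk : k ∈ grpK n) :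
    cyc (odo n n * k) = {2 ^ n} := by
  induction n with
  | zero => exact cyc_zero _
  | succ n ih =>
    obtain ⟨z, hz, u, hu, v, hv, rfl⟩ := exists_pair_eq_of_mem_grpK_succ hk
    have hmem : 1 * z * v * 1 * z ∈ grpK n :=
      mul_mem_grpK_of_mem_grpL (one_mem _) (one_mem _) (one_mem _) hz hv
    rw [one_mul, mul_one] at hmem
    rw [odo_succ_self, cyc_pair_mul_halfSwap_mul_pair, mul_one, mul_assoc (odo n n),
      mul_assoc (odo n n), mul_assoc (odo n n), ih (mul_mem hmem hu), Multiset.map_singleton,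
      pow_succ']

theorem two_le_card_cyc {n : ℕ} {k : Equiv.Perm (Fin (2 ^ (n + 1)))} (hk : k ∈ grpK (n + 1)) :
    2 ≤ (cyc k).card := by
  obtain ⟨z, -, u, -, v, -, rfl⟩ := exists_pair_eq_of_mem_grpK_succ hk
  rw [cyc_pair, Multiset.card_add]
  exact Nat.add_le_add (card_cyc_pos _) (card_cyc_pos _)

/-! ### The elements `m_n` and `x_n m_n` -/

open scoped commutatorElement in
theorem commutator_halfSwap_odo (n : ℕ) :
    ⁅halfSwap n, odo (n + 1) (n + 1)⁆ = pair (odo n n)⁻¹ (odo n n) := by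
  simp only [commutatorElement_def, odo_succ_self, mul_inv_rev, pair_inv, halfSwap_inv, mul_assoc,
    halfSwap_mul_pair_mul, halfSwap_mul_halfSwap_mul, halfSwap_mul_self, pair_mul, one_mul,
    mul_one, inv_one]

theorem halfSwap_mem_centralizerMod_grpK (n : ℕ) :
    halfSwap n ∈ centralizerMod (grpK (n + 1)) (odo (n + 1) (n + 1)) := by
  refine ⟨halfSwap_mem_normalizer_grpK n, ?_⟩
  rw [commutator_halfSwap_odo]
  simpa using pair_odo_mul_mem_grpK (inv_mem (odo_mul_odo_mem_grpK n)) (one_mem _)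

theorem mElt_add_two_mem_normalizer_grpK (n : ℕ) : mElt (n + 2) ∈
    Subgroup.normalizer (grpK (n + 2) : Set (Equiv.Perm (Fin (2 ^ (n + 2))))) := by
  rw [mElt_add_two]
  exact pair_mem_normalizer_grpK (halfSwap_mem_centralizerMod_grpK n)
    (mul_mem (odo_mem_centralizerMod_grpK _) (halfSwap_mem_centralizerMod_grpK n))

theorem mElt_add_two_mul_self_mem_grpK (n : ℕ) : mElt (n + 2) * mElt (n + 2) ∈ grpK (n + 2) := by
  rw [mElt_add_two, pair_mul, halfSwap_mul_self, ← pair_odo_one, pair_mul, one_mul]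
  exact pair_mem_grpK (one_mem _) (pair_mem_grpK (odo_mul_odo_mem_grpK n) (one_mem _))

open scoped commutatorElement in
theorem exists_commutator_mElt_odo_eq (n : ℕ) : ∃ u ∈ grpK (n + 1),
    ⁅mElt (n + 2), odo (n + 2) (n + 2)⁆ =
      pair (odo (n + 1) (n + 1) * u) (odo (n + 1) (n + 1)) := by
  set x := odo (n + 1) (n + 1)
  have hx := odo_mem_normalizer_grpK (n + 1)
  refine ⟨x⁻¹ * ⁅halfSwap n, x⁆ * x⁻¹⁻¹ * (x * x)⁻¹,
    mul_mem (conj_mem_of_mem_normalizer (inv_mem hx) (halfSwap_mem_centralizerMod_grpK n).2)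
      (inv_mem (odo_mul_odo_mem_grpK (n + 1))), ?_⟩
  rw [commutatorElement_def, mul_assoc (mElt _), mul_assoc (mElt _), ← mul_assoc (odo _ _),
    mElt_add_two, pair_inv, odo_conj_pair, pair_mul, mul_inv_cancel_right]
  simp only [commutatorElement_def, halfSwap_inv, x, mul_inv_rev, inv_inv, mul_assoc,
    mul_inv_cancel_left]

theorem mElt_mem_centralizerMod_grpK : ∀ n, mElt n ∈ centralizerMod (grpK n) (odo n n)
  | 0 => one_mem _
  | 1 => one_mem _
  | n + 2 => by
    obtain ⟨u, hu, h⟩ := exists_commutator_mElt_odo_eq n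
    refine ⟨mElt_add_two_mem_normalizer_grpK n, h ▸ ?_⟩
    simpa using pair_odo_mul_mem_grpK hu (one_mem _)

theorem mElt_mul_self_mem_grpK : ∀ n, mElt n * mElt n ∈ grpK n
  | 0 => one_mem _
  | 1 => one_mem _
  | n + 2 => mElt_add_two_mul_self_mem_grpK n

theorem exists_odo_mul_mElt_eq : ∀ n, ∃ c ∈ centralizerMod (grpK n) (odo n n),
    ∃ d ∈ centralizerMod (grpK n) (odo n n), c * d ∈ grpK n ∧
      odo (n + 1) (n + 1) * mElt (n + 1) = pair c d * halfSwap n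
  | 0 => ⟨1, one_mem _, 1, one_mem _, one_mem _, odo_succ_self 0⟩
  | n + 1 => by
    have hx := odo_mem_centralizerMod_grpK (n + 1)
    have hs := halfSwap_mem_centralizerMod_grpK n
    refine ⟨odo (n + 1) (n + 1) * (odo (n + 1) (n + 1) * halfSwap n), mul_mem hx (mul_mem hx hs),
      halfSwap n, hs, ?_, ?_⟩
    · rw [mul_assoc, mul_assoc, halfSwap_mul_self, mul_one]
      exact odo_mul_odo_mem_grpK (n + 1)
    · rw [mElt_add_two, odo_succ_self (n + 1), mul_assoc, halfSwap_mul_pair, ← mul_assoc, pair_mul,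
        one_mul]

theorem odo_mul_mElt_mem_normalizer_grpK (n : ℕ) : odo n n * mElt n ∈
    Subgroup.normalizer (grpK n : Set (Equiv.Perm (Fin (2 ^ n)))) :=
  mul_mem (odo_mem_normalizer_grpK n) (mElt_mem_centralizerMod_grpK n).1

theorem odo_mul_mElt_mul_self_mem_grpK (n : ℕ) :
    odo n n * mElt n * (odo n n * mElt n) ∈ grpK n := by
  have h := mul_mul_mul_mul_mem (odo_mem_normalizer_grpK n) (mElt_mem_centralizerMod_grpK n)
    (odo_mul_odo_mem_grpK n) (mElt_mul_self_mem_grpK n) (one_mem _)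
  rwa [mul_one, mul_assoc] at h

theorem two_le_card_cyc_odo_mul_mElt_mul {n : ℕ} {k : Equiv.Perm (Fin (2 ^ (n + 2)))}
    (hk : k ∈ grpK (n + 2)) : 2 ≤ (cyc (odo (n + 2) (n + 2) * mElt (n + 2) * k)).card := by
  obtain ⟨c, hc, d, hd, hcd, hy⟩ := exists_odo_mul_mElt_eq (n + 1)
  obtain ⟨z, hz, u, hu, v, hv, rfl⟩ := exists_pair_eq_of_mem_grpK_succ hk
  rw [hy, cyc_pair_mul_halfSwap_mul_pair, Multiset.card_map]
  exact two_le_card_cyc (mul_mem (mul_mem_grpK_of_mem_grpL hc hd hcd hz hv) hu)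

/-! ### The group `N_n` and its odometer part -/

theorem grpH_le_grpM (n : ℕ) : grpH n ≤ grpM n :=
  Subgroup.closure_mono (Set.union_subset_union_left _ (Set.singleton_subset_iff.2 (Or.inr rfl)))

theorem grpH_le_grpN (n : ℕ) : grpH n ≤ grpN n := fun w hw =>
  ⟨⟨w, grpH_le_grpM n hw⟩, Subgroup.subset_normalClosure (Subgroup.mem_subgroupOf.2 hw), rfl⟩

theorem mElt_mem_grpN (n : ℕ) : mElt n ∈ grpN n :=
  grpH_le_grpN n (Subgroup.subset_closure (Or.inl rfl))

theorem vElt_mem_grpN {n i : ℕ} (hi : i + 3 ≤ n) : vElt n i ∈ grpN n :=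
  grpH_le_grpN n (Subgroup.subset_closure (Or.inr ⟨i, hi, rfl⟩))

theorem grpM_le_normalizer_grpN (n : ℕ) :
    grpM n ≤ Subgroup.normalizer (grpN n : Set (Equiv.Perm (Fin (2 ^ n)))) := by
  refine Subgroup.le_normalizer_iff.2 ?_
  rintro g hg _ ⟨w, hw, rfl⟩
  exact ⟨⟨g, hg⟩ * w * ⟨g, hg⟩⁻¹, Subgroup.normalClosure_normal.conj_mem w hw _, rfl⟩

theorem grpN_le {n : ℕ} {A : Subgroup (Equiv.Perm (Fin (2 ^ n)))} (hH : grpH n ≤ A)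
    (hM : grpM n ≤ Subgroup.normalizer (A : Set (Equiv.Perm (Fin (2 ^ n))))) : grpN n ≤ A := by
  have : (A.subgroupOf (grpM n)).Normal := Subgroup.normal_subgroupOf_of_le_normalizer hM
  exact Subgroup.map_le_iff_le_comap.2
    (Subgroup.normalClosure_le_normal (N := A.subgroupOf (grpM n)) fun w hw => hH hw)

theorem vElt_mem_grpK {n i : ℕ} (hi : i + 2 ≤ n) : vElt n i ∈ grpK n := by
  induction n, hi using Nat.le_induction with
  | base =>
    rw [vElt, sq]
    exact odo_mul_odo_mem_grpK (i + 2)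
  | succ n hi ih =>
    rw [vElt_succ_of_le hi]
    exact pair_mem_grpK ih (one_mem _)

theorem grpN_le_grpK_sup (n : ℕ) : grpN n ≤ grpK n ⊔ Subgroup.zpowers (mElt n) := by
  have hm : mElt n ∈ grpK n ⊔ Subgroup.zpowers (mElt n) :=
    Subgroup.mem_sup_right (Subgroup.mem_zpowers _)
  have hv {i : ℕ} (hi : i + 3 ≤ n) : vElt n i ∈ grpK n ⊔ Subgroup.zpowers (mElt n) :=
    Subgroup.mem_sup_left (vElt_mem_grpK (by omega))
  have hx : odo n n ∈ centralizerMod (grpK n) (mElt n) :=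
    grpL_le_centralizerMod (mElt_mem_centralizerMod_grpK n)
      (Subgroup.mem_sup_right (Subgroup.mem_zpowers _))
  refine grpN_le ?_ ?_
  · rw [grpH, Subgroup.closure_le]
    rintro _ (rfl | ⟨i, hi, rfl⟩)
    exacts [hm, hv hi]
  · rw [grpM, Subgroup.closure_le]
    rintro _ ((rfl | rfl) | ⟨i, hi, rfl⟩)
    exacts [centralizerMod_le_normalizer_sup _ _ hx, Subgroup.le_normalizer hm,
      Subgroup.le_normalizer (hv hi)]

/-- The part of `A` supported on the left subtree, as a group of permutations of the leaves of that
subtree. -/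
def leftPart {n : ℕ} (A : Subgroup (Equiv.Perm (Fin (2 ^ (n + 1))))) :
    Subgroup (Equiv.Perm (Fin (2 ^ n))) :=
  A.comap ((pairHom n).comp (MonoidHom.inl _ _))

theorem mem_leftPart {n : ℕ} {A : Subgroup (Equiv.Perm (Fin (2 ^ (n + 1))))}
    {u : Equiv.Perm (Fin (2 ^ n))} : u ∈ leftPart A ↔ pair u 1 ∈ A :=
  Iff.rfl

section LeftPart

variable {n : ℕ} {A : Subgroup (Equiv.Perm (Fin (2 ^ (n + 1))))}

theorem odo_mem_normalizer_leftPart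
    (hA : odo (n + 1) (n + 1) ∈ Subgroup.normalizer (A : Set (Equiv.Perm (Fin (2 ^ (n + 1)))))) :
    odo n n ∈ Subgroup.normalizer (leftPart A : Set (Equiv.Perm (Fin (2 ^ n)))) := by
  refine Subgroup.mem_normalizer_iff.2 fun u => ?_
  rw [mem_leftPart, mem_leftPart, Subgroup.mem_normalizer_iff.1 (pow_mem hA 2) (pair u 1),
    odo_succ_self_sq, pair_inv, pair_mul, pair_mul, mul_one, mul_inv_cancel]

theorem pairSubgroup_le {K : Subgroup (Equiv.Perm (Fin (2 ^ n)))}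
    (hA : odo (n + 1) (n + 1) ∈ Subgroup.normalizer (A : Set (Equiv.Perm (Fin (2 ^ (n + 1))))))
    (hK : K ≤ leftPart A) : pairSubgroup K ≤ A := by
  intro w hw
  obtain ⟨u, hu, v, hv, rfl⟩ := mem_pairSubgroup.1 hw
  have hright : pair 1 v ∈ A := by
    have := conj_mem_of_mem_normalizer hA (mem_leftPart.1 (hK hv))
    rwa [odo_conj_pair, mul_one, mul_inv_cancel] at this
  rw [← mul_one u, ← one_mul v, ← pair_mul]
  exact mul_mem (hK hu) hright

end LeftPart

theorem grpK_le_of_vElt_mem {n : ℕ} {A : Subgroup (Equiv.Perm (Fin (2 ^ n)))}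
    (hA : odo n n ∈ Subgroup.normalizer (A : Set (Equiv.Perm (Fin (2 ^ n)))))
    (hv : ∀ i, i + 2 ≤ n → vElt n i ∈ A) : grpK n ≤ A := by
  induction n with
  | zero => exact bot_le
  | succ n ih =>
    have hleft : grpK n ≤ leftPart A := ih (odo_mem_normalizer_leftPart hA) fun i hi => by
      rw [mem_leftPart, ← vElt_succ_of_le hi]
      exact hv i (by omega)
    refine sup_le (pairSubgroup_le hA hleft) (Subgroup.zpowers_le.2 ?_)
    rcases n with _ | n
    · rw [odo, pair_one]
      exact one_mem A
    · rw [← odo_succ_self_sq]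
      exact hv n le_rfl

theorem grpK_le_grpN : ∀ n, grpK n ≤ grpN n
  | 0 | 1 => grpK_le_of_vElt_mem (grpM_le_normalizer_grpN _ (odo_mem_grpM _)) (by omega)
  | n + 2 => by
    have hA := grpM_le_normalizer_grpN _ (odo_mem_grpM (n + 2))
    have hleft : grpK (n + 1) ≤ leftPart (grpN (n + 2)) :=
      grpK_le_of_vElt_mem (odo_mem_normalizer_leftPart hA) fun i hi => by
        rw [mem_leftPart, ← vElt_succ_of_le hi]
        exact vElt_mem_grpN (by omega)
    refine sup_le (pairSubgroup_le hA hleft) (Subgroup.zpowers_le.2 ?_)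
    obtain ⟨u, hu, hcomm⟩ := exists_commutator_mElt_odo_eq n
    have hmem : pair (odo (n + 1) (n + 1) * u) (odo (n + 1) (n + 1)) ∈ grpN (n + 2) := by
      rw [← hcomm, commutatorElement_def, mul_assoc, mul_assoc, ← mul_assoc (odo _ _)]
      exact mul_mem (mElt_mem_grpN _) (conj_mem_of_mem_normalizer hA (inv_mem (mElt_mem_grpN _)))
    have h := mul_mem hmem (inv_mem (mem_leftPart.1 (hleft hu)))
    rwa [pair_inv, pair_mul, mul_inv_cancel_right, inv_one, mul_one] at h

theorem mem_grpK_of_mem_od : ∀ {n : ℕ} {w : Equiv.Perm (Fin (2 ^ n))},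
    w ∈ od n (grpN n) → w ∈ grpK n
  | 0, w, ⟨hw, _⟩ => by simpa [mElt] using grpN_le_grpK_sup 0 hw
  | 1, w, ⟨hw, _⟩ => by simpa [mElt] using grpN_le_grpK_sup 1 hw
  | n + 2, w, ⟨hw, hodo⟩ => by
    obtain ⟨b, k, hk, rfl⟩ := (mem_sup_zpowers_iff (mElt_mem_centralizerMod_grpK _).1
      (mElt_mul_self_mem_grpK _)).1 (grpN_le_grpK_sup _ hw)
    cases b with
    | false => simpa using hk
    | true =>
      have hcard := two_le_card_cyc_odo_mul_mElt_mul hk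
      rw [isOdometer_iff_card_cyc, Bool.toNat_true, pow_one, ← mul_assoc] at hodo
      omega

theorem od_grpN (n : ℕ) : od n (grpN n) = grpK n := by
  refine Set.Subset.antisymm (fun _ => mem_grpK_of_mem_od) fun w hw => ⟨grpK_le_grpN n hw, ?_⟩
  rw [isOdometer_iff_card_cyc, cyc_odo_mul hw, Multiset.card_singleton]

theorem grpM2_eq (n : ℕ) : grpM2 n = grpK n ⊔ Subgroup.zpowers (odo n n * mElt n) := by
  rw [grpM2, od_grpN, Subgroup.closure_union, Subgroup.closure_eq, sup_comm,
    ← Subgroup.zpowers_eq_closure]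

/-! ### Uniform distributions on subgroups -/

/-- A fair coin. -/
noncomputable def coin : PMF Bool :=
  PMF.uniformOfFintype Bool

section Coin

variable {α : Type*}

theorem coin_bind_apply (f : Bool → PMF α) (x : α) :
    (coin.bind f) x = 2⁻¹ * f true x + 2⁻¹ * f false x := by
  rw [PMF.bind_apply, tsum_fintype, Fintype.sum_bool]
  simp [coin]

theorem coin_bind_not (f : Bool → PMF α) : (coin.bind fun b => f (!b)) = coin.bind f := by
  ext x
  rw [coin_bind_apply, coin_bind_apply, Bool.not_true, Bool.not_false, add_comm]

end Coin

theorem pmf_bind_eq_of_forall_support {α β : Type*} {p : PMF α} {f : α → PMF β} {q : PMF β}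
    (h : ∀ x ∈ p.support, f x = q) : p.bind f = q := by
  refine Eq.trans ?_ (PMF.bind_const p q)
  ext y
  rw [PMF.bind_apply, PMF.bind_apply]
  refine tsum_congr fun x => ?_
  by_cases hx : x ∈ p.support
  · rw [h x hx]
  · rw [(PMF.apply_eq_zero_iff p x).2 hx, zero_mul, zero_mul]

section UniformPMF

variable {G : Type*} [Group G]

theorem pmf_map_mul_left_apply (p : PMF G) (t g : G) : p.map (t * ·) (t * g) = p g := by
  rw [← PMF.toOuterMeasure_apply_singleton, PMF.toOuterMeasure_map_apply,
    show (t * ·) ⁻¹' {t * g} = {g} by simp, PMF.toOuterMeasure_apply_singleton]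

variable [Finite G] {K : Subgroup G}

/-- The uniform distribution on a subgroup, as a distribution on the ambient finite group. -/
noncomputable def uniformPMF (K : Subgroup G) : PMF G :=
  PMF.uniformOfFinset (Set.toFinite (K : Set G)).toFinset
    ((Set.Finite.toFinset_nonempty _).2 (OneMemClass.coe_nonempty K))

theorem mem_support_uniformPMF {g : G} : g ∈ (uniformPMF K).support ↔ g ∈ K := by
  rw [uniformPMF, PMF.mem_support_uniformOfFinset_iff, Set.Finite.mem_toFinset, SetLike.mem_coe]

theorem toReal_uniformPMF_map_apply {α : Type*} (K : Subgroup G) (f : G → α) (x : α) :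
    ((uniformPMF K).map f x).toReal = (Nat.card {g : K // f g = x} : ℝ) / Nat.card K := by
  classical
  rw [← PMF.toOuterMeasure_apply_singleton, PMF.toOuterMeasure_map_apply, uniformPMF,
    PMF.toOuterMeasure_uniformOfFinset_apply, ENNReal.toReal_div, ENNReal.toReal_natCast,
    ENNReal.toReal_natCast, ← Nat.card_eq_card_finite_toFinset]
  congr 2
  rw [Nat.card_congr (Equiv.subtypeSubtypeEquivSubtypeInter (· ∈ K) fun g => f g = x)]
  exact (Nat.subtype_card _ fun g => by simp).symm

theorem uniformPMF_map_mul_left {t : G} (ht : t ∈ K) :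
    (uniformPMF K).map (t * ·) = uniformPMF K := by
  ext g
  obtain ⟨g, rfl⟩ := (Group.mulLeft_bijective t).surjective g
  rw [pmf_map_mul_left_apply]
  classical
  refine if_congr ?_ rfl rfl
  rw [Set.Finite.mem_toFinset, Set.Finite.mem_toFinset, SetLike.mem_coe, SetLike.mem_coe,
    Subgroup.mul_mem_cancel_left K ht]

theorem eq_uniformPMF {p : PMF G} (hp : ∀ g ∈ p.support, g ∈ K)
    (hinv : ∀ t ∈ K, p.map (t * ·) = p) : p = uniformPMF K := by
  have apply_eq {q : PMF G} (hq : ∀ t ∈ K, q.map (t * ·) = q) {g : G} (hg : g ∈ K) :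
      q g = q 1 := by
    rw [← pmf_map_mul_left_apply q g 1, hq g hg, mul_one]
  have apply_eq_zero {q : PMF G} (hq : ∀ g ∈ q.support, g ∈ K) {g : G} (hg : g ∉ K) : q g = 0 :=
    (PMF.apply_eq_zero_iff q g).2 fun h => hg (hq g h)
  set u := uniformPMF K
  have hu : ∀ t ∈ K, u.map (t * ·) = u := fun t ht => uniformPMF_map_mul_left ht
  have hsupp : ∀ g ∈ u.support, g ∈ K := fun g => mem_support_uniformPMF.1
  have hprop (g : G) : p g * u 1 = u g * p 1 := by
    by_cases hg : g ∈ K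
    · rw [apply_eq hinv hg, apply_eq hu hg, mul_comm]
    · rw [apply_eq_zero hp hg, apply_eq_zero hsupp hg, zero_mul, zero_mul]
  have hone : u 1 = p 1 := by
    have := tsum_congr (L := .unconditional G) hprop
    rwa [ENNReal.tsum_mul_right, ENNReal.tsum_mul_right, PMF.tsum_coe, PMF.tsum_coe, one_mul,
      one_mul] at this
  ext g
  by_cases hg : g ∈ K
  · rw [apply_eq hinv hg, apply_eq hu hg, hone]
  · rw [apply_eq_zero hp hg, apply_eq_zero hsupp hg]

theorem uniformPMF_map_mul_left_map_mul_left {t y : G}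
    (hy : y ∈ Subgroup.normalizer (K : Set G)) (ht : t ∈ K) :
    ((uniformPMF K).map (y * ·)).map (t * ·) = (uniformPMF K).map (y * ·) := by
  have hconj : y⁻¹ * t * y⁻¹⁻¹ ∈ K := conj_mem_of_mem_normalizer (inv_mem hy) ht
  conv_rhs => rw [← uniformPMF_map_mul_left hconj]
  rw [PMF.map_comp, PMF.map_comp]
  congr 1
  funext g
  simp only [Function.comp_apply, inv_inv, mul_assoc, mul_inv_cancel_left]

theorem uniformPMF_sup_zpowers {y : G} (hy : y ∈ Subgroup.normalizer (K : Set G))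
    (hyy : y * y ∈ K) : uniformPMF (K ⊔ Subgroup.zpowers y) =
      coin.bind fun b => (uniformPMF K).map (y ^ b.toNat * ·) := by
  refine (eq_uniformPMF (fun g hg => ?_) fun t ht => ?_).symm
  · obtain ⟨b, -, hg⟩ := (PMF.mem_support_bind_iff _ _ _).1 hg
    obtain ⟨k, hk, rfl⟩ := (PMF.mem_support_map_iff _ _ _).1 hg
    exact (mem_sup_zpowers_iff hy hyy).2 ⟨b, k, mem_support_uniformPMF.1 hk, rfl⟩
  have hflip (b : Bool) : ((uniformPMF K).map (y ^ b.toNat * ·)).map (y * ·) =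
      (uniformPMF K).map (y ^ (!b).toNat * ·) := by
    rw [PMF.map_comp]
    cases b
    · simp [Function.comp_def]
    · simpa [Function.comp_def, ← mul_assoc, show (fun g : G => g) = id from rfl, PMF.map_id]
        using uniformPMF_map_mul_left hyy
  obtain ⟨b, k, hk, rfl⟩ := (mem_sup_zpowers_iff hy hyy).1 ht
  have hmap : (fun g => y ^ b.toNat * k * g) = (y ^ b.toNat * ·) ∘ (k * ·) :=
    funext fun g => mul_assoc _ _ _
  rw [hmap, ← PMF.map_comp, PMF.map_bind]
  simp only [uniformPMF_map_mul_left_map_mul_left (pow_mem hy _) hk]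
  cases b with
  | false =>
    simp only [Bool.toNat_false, pow_zero, one_mul]
    exact PMF.map_id _
  | true =>
    simpa only [Bool.toNat_true, pow_one, PMF.map_bind, hflip] using
      coin_bind_not fun b => (uniformPMF K).map (y ^ b.toNat * ·)

end UniformPMF

/-! ### The degrees in the Markov process -/

/-- The distribution of the sum of two independent random multisets. -/
noncomputable def convSum (p q : PMF (Multiset ℕ)) : PMF (Multiset ℕ) :=
  p.bind fun c => q.map (c + ·)

theorem convSum_pure (c e : Multiset ℕ) : convSum (PMF.pure c) (PMF.pure e) = PMF.pure (c + e) := by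
  rw [convSum, PMF.pure_bind, PMF.pure_map]

theorem convSum_bind {α β : Type*} (p : PMF α) (q : PMF β) (f : α → PMF (Multiset ℕ))
    (g : β → PMF (Multiset ℕ)) :
    convSum (p.bind f) (q.bind g) = p.bind fun x => q.bind fun y => convSum (f x) (g y) := by
  simp only [convSum, PMF.bind_bind, PMF.map_bind]
  exact congrArg p.bind (funext fun x => PMF.bind_comm _ _ _)

theorem convSum_map_multisetMap (p q : PMF (Multiset ℕ)) (f : ℕ → ℕ) :
    (convSum p q).map (Multiset.map f) =
      convSum (p.map (Multiset.map f)) (q.map (Multiset.map f)) := by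
  simp only [convSum, PMF.map_bind, PMF.bind_map, PMF.map_comp, Function.comp_def,
    Multiset.map_add]

/-- The distribution of the degrees after `k` steps of the Markov process started at `L`. -/
noncomputable def degreeLaw : ℕ → Datum → PMF (Multiset ℕ)
  | 0, L => PMF.pure (degrees L)
  | k + 1, L => (step L).bind (degreeLaw k)

theorem iterate_bind_step_map_degrees (k : ℕ) (p : PMF Datum) :
    ((fun D => D.bind step)^[k] p).map degrees = p.bind (degreeLaw k) := by
  induction k generalizing p with
  | zero => rfl
  | succ k ih =>
    rw [Function.iterate_succ_apply, ih, PMF.bind_bind]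
    rfl

theorem step_append (L L' : Datum) :
    step (L ++ L') = (step L).bind fun D => (step L').bind fun D' => PMF.pure (D ++ D') := by
  induction L with
  | nil => simp only [step, PMF.pure_bind, List.nil_append, PMF.bind_pure]
  | cons F L ih =>
    simp only [List.cons_append, step, ih, PMF.map_bind, PMF.bind_map, PMF.bind_bind, PMF.pure_map,
      Function.comp_def, List.append_assoc]

theorem step_singleton (F : FType × ℕ) : step [F] = children F := by
  simp [step, PMF.pure_map, PMF.bind_pure]

theorem degreeLaw_append (k : ℕ) (L L' : Datum) :
    degreeLaw k (L ++ L') = convSum (degreeLaw k L) (degreeLaw k L') := by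
  induction k generalizing L L' with
  | zero => simp [degreeLaw, convSum_pure, degrees]
  | succ k ih =>
    simp only [degreeLaw, step_append, PMF.bind_bind, PMF.pure_bind, convSum_bind, ih]

theorem children_nn (d : ℕ) : children (nn, d) = PMF.pure [(nn, 2 * d)] := by
  simp [children, nn, act]

theorem uniformOfFinset_allowable_ss :
    PMF.uniformOfFinset (allowable ss) (allowable_nonempty ss) =
      coin.bind fun b => PMF.pure (if b then (nn, nn) else (ss, ss)) := by
  have hallowable : allowable ss = {(nn, nn), (ss, ss)} := by decide
  have hne : ((ss, ss) : FType × FType) ≠ (nn, nn) := by decide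
  ext P
  rw [coin_bind_apply, PMF.uniformOfFinset_apply, hallowable]
  by_cases hnn : P = (nn, nn)
  · simp [hnn, hne.symm]
  · by_cases hss : P = (ss, ss)
    · simp [hss, hne, hne.symm]
    · simp [hnn, hss]

theorem children_ss (d : ℕ) : children (ss, d) =
    coin.bind fun b => PMF.pure (if b then [(nn, d), (nn, d)] else [(ss, d), (ss, d)]) := by
  rw [children, if_pos (show (ss, d).1.1 = true from rfl), uniformOfFinset_allowable_ss,
    PMF.map_bind]
  refine congrArg coin.bind (funext fun b => ?_)
  rw [PMF.pure_map]
  cases b <;> rfl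

theorem degreeLaw_nn (k d : ℕ) : degreeLaw k [(nn, d)] = PMF.pure {2 ^ k * d} := by
  induction k generalizing d with
  | zero => simp [degreeLaw, degrees]
  | succ k ih =>
    rw [degreeLaw, step_singleton, children_nn, PMF.pure_bind, ih, pow_succ, mul_assoc]

theorem degreeLaw_zero_ss (d : ℕ) : degreeLaw 0 [(ss, d)] = PMF.pure {d} := by
  rw [degreeLaw]
  rfl

theorem degreeLaw_succ_ss (k d : ℕ) : degreeLaw (k + 1) [(ss, d)] = coin.bind fun b =>
    if b then PMF.pure {2 ^ k * d, 2 ^ k * d}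
    else convSum (degreeLaw k [(ss, d)]) (degreeLaw k [(ss, d)]) := by
  rw [degreeLaw, step_singleton, children_ss, PMF.bind_bind]
  refine congrArg coin.bind (funext fun b => ?_)
  rw [PMF.pure_bind]
  cases b with
  | false => exact degreeLaw_append k [(ss, d)] [(ss, d)]
  | true =>
    refine (degreeLaw_append k [(nn, d)] [(nn, d)]).trans ?_
    rw [degreeLaw_nn, convSum_pure]
    rfl

theorem degreeLaw_ss_map_two_mul (k d : ℕ) :
    (degreeLaw k [(ss, d)]).map (Multiset.map (2 * ·)) = degreeLaw k [(ss, 2 * d)] := by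
  induction k with
  | zero => rw [degreeLaw_zero_ss, degreeLaw_zero_ss, PMF.pure_map, Multiset.map_singleton]
  | succ k ih =>
    rw [degreeLaw_succ_ss, degreeLaw_succ_ss, PMF.map_bind]
    refine congrArg coin.bind (funext fun b => ?_)
    cases b with
    | false => simp only [Bool.false_eq_true, if_false, convSum_map_multisetMap, ih]
    | true => simp [PMF.pure_map, mul_left_comm]

theorem model4_eq : model4 = coin.bind fun b =>
    if b then PMF.pure [(ss, 2)] else children (ss, 1) := by
  ext D
  have hquarter : (2 : ENNReal)⁻¹ * 2⁻¹ = 4⁻¹ := by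
    rw [← ENNReal.mul_inv (by simp) (by simp)]
    norm_num
  change firstWeight D = _
  rw [coin_bind_apply, children_ss, firstWeight]
  simp only [if_true, Bool.false_eq_true, if_false, coin_bind_apply, PMF.pure_apply]
  by_cases hirred : D = [(ss, 2)]
  · simp [hirred]
  · by_cases hnn : D = [(nn, 1), (nn, 1)]
    · simp [hnn, hquarter, nn, ss]
    · by_cases hss : D = [(ss, 1), (ss, 1)]
      · simp [hss, hquarter, nn, ss]
      · simp [hirred, hnn, hss]

theorem levelData_map_degrees (n : ℕ) : (levelData (n + 1)).map degrees =
    coin.bind fun b => if b then degreeLaw n [(ss, 2)] else degreeLaw (n + 1) [(ss, 1)] := by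
  rw [levelData, iterate_bind_step_map_degrees, model4_eq, PMF.bind_bind, Nat.add_sub_cancel]
  refine congrArg coin.bind (funext fun b => ?_)
  cases b with
  | false =>
    rw [degreeLaw, step_singleton]
    rfl
  | true => exact PMF.pure_bind _ _

/-! ### The cycle types in `K_n` and `M_n(2)` -/

theorem uniformPMF_pairSubgroup {n : ℕ} (K : Subgroup (Equiv.Perm (Fin (2 ^ n)))) :
    uniformPMF (pairSubgroup K) =
      (uniformPMF K).bind fun v => (uniformPMF K).map fun u => pair u v := by
  refine (eq_uniformPMF (fun g hg => ?_) fun t ht => ?_).symm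
  · obtain ⟨v, hv, hg⟩ := (PMF.mem_support_bind_iff _ _ _).1 hg
    obtain ⟨u, hu, rfl⟩ := (PMF.mem_support_map_iff _ _ _).1 hg
    exact pair_mem_pairSubgroup (mem_support_uniformPMF.1 hu) (mem_support_uniformPMF.1 hv)
  · obtain ⟨c, hc, d, hd, rfl⟩ := mem_pairSubgroup.1 ht
    have hleft (v : Equiv.Perm (Fin (2 ^ n))) : (uniformPMF K).map (fun u => pair (c * u) v) =
        (uniformPMF K).map fun u => pair u v := by
      conv_rhs => rw [← uniformPMF_map_mul_left hc, PMF.map_comp]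
      rfl
    simp only [PMF.map_bind, PMF.map_comp, Function.comp_def, pair_mul, hleft]
    conv_rhs =>
      arg 1
      rw [← uniformPMF_map_mul_left hd]
    rw [PMF.bind_map]
    rfl

theorem uniformPMF_grpK_map_cyc (n : ℕ) :
    (uniformPMF (grpK n)).map cyc = degreeLaw n [(ss, 1)] := by
  induction n with
  | zero =>
    rw [degreeLaw_zero_ss]
    exact pmf_bind_eq_of_forall_support fun w _ => congrArg PMF.pure (cyc_zero w)
  | succ n ih =>
    rw [grpK, uniformPMF_sup_zpowers (pair_odo_odo_mem_normalizer n) (pair_odo_odo_mul_self_mem n),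
      degreeLaw_succ_ss, PMF.map_bind]
    refine congrArg coin.bind (funext fun b => ?_)
    cases b with
    | false =>
      simp only [Bool.toNat_false, pow_zero, one_mul, Bool.false_eq_true, if_false, ← ih, convSum,
        uniformPMF_pairSubgroup, PMF.map_bind, PMF.bind_map, PMF.map_comp, Function.comp_def,
        cyc_pair, add_comm]
    | true =>
      rw [PMF.map_comp]
      refine pmf_bind_eq_of_forall_support fun w hw => congrArg PMF.pure ?_
      obtain ⟨u, hu, v, hv, rfl⟩ := mem_pairSubgroup.1 (mem_support_uniformPMF.1 hw)
      rw [Function.comp_apply, Bool.toNat_true, pow_one, pair_mul, cyc_pair, cyc_odo_mul hu,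
        cyc_odo_mul hv, mul_one]
      rfl

theorem uniformPMF_grpK_map_cyc_odo_mul_mElt_mul (n : ℕ) :
    (uniformPMF (grpK (n + 1))).map (fun k => cyc (odo (n + 1) (n + 1) * mElt (n + 1) * k)) =
      degreeLaw n [(ss, 2)] := by
  obtain ⟨c, hc, d, hd, hcd, hy⟩ := exists_odo_mul_mElt_eq n
  rw [grpK, uniformPMF_sup_zpowers (pair_odo_odo_mem_normalizer n) (pair_odo_odo_mul_self_mem n),
    uniformPMF_pairSubgroup, PMF.map_bind]
  refine pmf_bind_eq_of_forall_support fun b _ => ?_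
  set z := odo n n ^ b.toNat with hz_def
  have hz : z ∈ grpL n := pow_mem (Subgroup.mem_sup_right (Subgroup.mem_zpowers _)) _
  rw [PMF.map_bind, PMF.map_bind]
  refine pmf_bind_eq_of_forall_support fun v hv => ?_
  have ht := mul_mem_grpK_of_mem_grpL hc hd hcd hz (mem_support_uniformPMF.1 hv)
  calc _ = (uniformPMF (grpK n)).map fun u => (cyc (c * z * v * d * z * u)).map (2 * ·) := by
        simp only [PMF.map_comp, Function.comp_def, hy, pair_pow, pair_mul, ← hz_def,
          cyc_pair_mul_halfSwap_mul_pair]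
    _ = (uniformPMF (grpK n)).map fun u => (cyc u).map (2 * ·) := by
        conv_rhs => rw [← uniformPMF_map_mul_left ht, PMF.map_comp]
        rfl
    _ = degreeLaw n [(ss, 2)] := by
        refine Eq.trans ?_ (degreeLaw_ss_map_two_mul n 1)
        rw [← uniformPMF_grpK_map_cyc, PMF.map_comp]
        rfl

theorem uniformPMF_grpM2_map_cyc (n : ℕ) :
    (uniformPMF (grpM2 (n + 1))).map cyc = (levelData (n + 1)).map degrees := by
  rw [grpM2_eq, uniformPMF_sup_zpowers (odo_mul_mElt_mem_normalizer_grpK _)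
    (odo_mul_mElt_mul_self_mem_grpK _), PMF.map_bind, levelData_map_degrees]
  refine congrArg coin.bind (funext fun b => ?_)
  rw [PMF.map_comp]
  cases b with
  | false =>
    simp only [Bool.toNat_false, pow_zero, one_mul]
    exact uniformPMF_grpK_map_cyc (n + 1)
  | true =>
    simp only [Bool.toNat_true, pow_one]
    exact uniformPMF_grpK_map_cyc_odo_mul_mElt_mul n

theorem cycleData_grpM2 (n : ℕ) : cycleData (grpM2 (n + 1)) = levelCycleData (n + 1) := by
  ext ⟨c, r⟩
  simp only [cycleData, levelCycleData, ← uniformPMF_grpM2_map_cyc, Set.mem_ofPred_eq,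
    toReal_uniformPMF_map_apply, PMF.mem_support_map_iff, mem_support_uniformPMF]

theorem corollary5p18_general (a : ℤ) :
    (∀ (p : ℕ) [Fact p.Prime], IsSquare (-1 : ZMod p) → IsSquare (2 - a : ZMod p) →
      ∃ D ∈ firstLevel, factType a p = (D : Multiset (FType × ℕ))) ∧
    ∀ n : ℕ, 1 ≤ n → grpM2 n ≤ treeAut n ∧ cycleData (grpM2 n) = levelCycleData n := by
  refine ⟨fun p _ hneg hγ => factType_mem_firstLevel hneg hγ, fun n hn => ?_⟩
  obtain ⟨n, rfl⟩ := Nat.exists_eq_add_of_le' hn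
  exact ⟨grpM2_le_treeAut _, cycleData_grpM2 n⟩

end EvenMarkov

theorem corollary5p18 (a b : ℤ) (hab : a = 2 + b ^ 2 ∨ a = 2 - b ^ 2)
    (hirr : Irreducible (EvenMarkov.gPoly a)) :
    (∀ (p : ℕ) [Fact p.Prime], p % 4 = 1 →
      ∃ D ∈ EvenMarkov.firstLevel, EvenMarkov.factType a p = (D : Multiset (EvenMarkov.FType × ℕ))) ∧
    ∀ n : ℕ, 1 ≤ n →
      EvenMarkov.grpM2 n ≤ EvenMarkov.treeAut n ∧
      EvenMarkov.cycleData (EvenMarkov.grpM2 n) = EvenMarkov.levelCycleData n := by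
  obtain ⟨hfact, hgroup⟩ := EvenMarkov.corollary5p18_general a
  refine ⟨fun p _ hp => ?_, hgroup⟩
  have hneg : IsSquare (-1 : ZMod p) := ZMod.exists_sq_eq_neg_one_iff.2 (by omega)
  exact hfact p hneg (EvenMarkov.isSquare_two_sub_cast hneg hab)
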